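/- **Setting.** Let $E$ be a finite-dimensional Euclidean space with inner product $\langle\cdot,\cdot\rangle$ and Euclidean norm $\|\cdot\|_2$, let $\|\cdot\|$ be another norm on $E$ and $\|\cdot\|_*$ its conjugate norm, and let $X\subset E$ be closed and convex with nonempty interior. A *sparsity structure* is a family $\mathcal P$ of linear projectors $P=P^2$ on $E$ with weights $\pi(P)\ge 0$; $z\in E$ is *$t$-sparse* if $Pz=z$ for some $P\in\mathcal P$ with $\pi(P)\le t$. Let $0\le s\le\bar s$. We assume that $\|z\|\le\sqrt t\,\|z\|_2$ for every $t\ge0$ and every $t$-sparse $z$, that the difference of two $s$-sparse vectors is $2s$-sparse, and that $\mathrm{sparse}(\cdot)$ is a (Borel) map which sends each $x\in X$ to a minimizer of $\|x-z\|_2$ over the $s$-sparse $z\in X$. Let $\vartheta:E\to\mathbb R$ be convex and $C^1$ with $\vartheta\ge\vartheta(0)=0$, $\langle\nabla\vartheta(x)-\nabla\vartheta(x'),x-x'\rangle\ge\|x-x'\|^2$ and $\vartheta(x)\le\Theta\|x\|^2$ for all $x,x'\in E$, where $\Theta\ge\frac12$. Let $\kappa>0$, $\varkappa,\varkappa'\ge1$,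 $0\le\mathcal L\le\nu$, $\varsigma_*\ge0$, $R\in\mathbb R$, $x_0\in X$. **Problems.** $\mathcal X$ is the class of problems $\min_{x\in X}g(x)$, $g(x)=\mathbf E\{G(x,\omega)\}$, $\omega\sim P$, such that on $X$: $g$ is finite, convex and differentiable, with $\|\nabla g(x')-\nabla g(x)\|_*\le\mathcal L\|x-x'\|$; $g$ has a minimizer $x_*$ with $g(x)-g(x_*)\ge\frac\kappa2\|x-x_*\|_2^2$; $x_*$ is $s$-sparse and $\|x_*-x_0\|\le R$; for almost every $\omega$, $G(\cdot,\omega)$ is differentiable; $\mathbf E\{\nabla G(x,\omega)\}=\nabla g(x)$; and $\zeta(x,\omega)=\nabla G(x,\omega)-\nabla g(x)$ satisfies $\mathbf E\|\zeta(x_*,\omega)\|_*^2\le\varsigma_*^2$ and $$\mathbf E\|\zeta(x,\omega)\|_*^2\le\varkappa\nu\,[g(x)-g(x_*)-\langle\nabla g(x_*),x-x_*\rangle]+\varkappa'\varsigma_*^2 .$$ Here gradients are taken within $X$, and $(x,\omega)\mapsto\nabla G(x,\omega)$ is measurable. **Algorithm 1** (with $N$ i.i.d. observations $\omega_i\sim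 P$, each used once). With $V_{y}(x,z)=\vartheta(z-y)-\vartheta(x-y)-\langle\nabla\vartheta(x-y),z-x\rangle$, let $\widehat x_m(y,\beta)=\frac1m\sum_{i=1}^m x_i$, where $x_i=\arg\min_{z\in X}\{\langle\nabla G(x_{i-1},\omega_i),z\rangle+\beta V_{y}(x_{i-1},z)\}$ is started at $y$ in place of $x_0$ and uses $m$ new observations. Put $m_0=\lceil16\kappa^{-1}\bar s(8\Theta\varkappa+1)\nu\rceil$, $m_k=\lceil512\,\bar s\Theta\nu\varkappa\kappa^{-1}2^k\rceil$ for $k\ge1$, and $\overline K=\max\{1,\lceil\log_2(R^2\kappa\nu\varkappa/(32\varsigma_*^2\bar s\varkappa'))\rceil\}$ (with $\overline K=\infty$ if $\varsigma_*=0$). *Preliminary phase:* $y_0=x_0$; for $k=1,\dots,K=\min\{\lfloor N/m_0\rfloor,\overline K\}$ set $y_k=\mathrm{sparse}(\widehat x_{m_0}(y_{k-1},2\varkappa\nu))$. If $m_1>N-m_0\overline K$, the output $\widehat x_N$ is the last $\widehat x_{m_0}(y_{K-1},2\varkappa\nu)$. Otherwise, *asymptotic phase:* $K'=\max\{k:\sum_{i=1}^k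 m_i\le N-m_0\overline K\}$, $y_0'=y_K$; for $k=1,\dots,K'$ set $y_k'=\mathrm{sparse}(\widehat x_{m_k}(y'_{k-1},2^k\nu\varkappa))$; the output is $\widehat x_N=\widehat x_{m_{K'}}(y'_{K'-1},2^{K'}\nu\varkappa)$. **Reliable solutions.** Let $\epsilon\in(0,\frac14]$, $L=\lceil\alpha\ln(1/\epsilon)\rceil$, $N=LM$. Run Algorithm 1 on $L$ independent samples of length $M$ to get $\widehat x^{(1)},\dots,\widehat x^{(L)}$, let $\overline x_N$ be given by one of the rules 1. $\overline x_N\in\mathrm{Argmin}_{x\in E}\sum_{\ell}\|x-\widehat x^{(\ell)}\|_2$; 2. $\overline x_N\in\mathrm{Argmin}_{x\in\{\widehat x^{(1)},\dots,\widehat x^{(L)}\}}\sum_\ell\|x-\widehat x^{(\ell)}\|_2$; 3. $\overline x_N=\widehat x^{(\hat\imath)}$, $\hat\imath\in\mathrm{Argmin}_i\,r^i_{(\lfloor L/2\rfloor+1)}$, where $r^i_{(1)}\le\dots\le r^i_{(L-1)}$ are the distances $\|\widehat x^{(i)}-\widehat x^{(j)}\|_2$, $j\ne i$, in increasing order, (any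 choice of the minimizers), and put $\overline y_N=\mathrm{sparse}(\overline x_N)$. For a norm $|\cdot|$ let $$\mathrm{Risk}_{|\cdot|,\epsilon}(\widehat x|\mathcal X)=\inf\Big\{r\ge0:\ \sup_{\mathcal X}\mathrm{Prob}\{|\widehat x-x_*|\ge r\}\le\epsilon\Big\}.$$ **Theorem.** Let $\alpha\ge10$ for rule 1, $\alpha\ge58.46$ for rule 2, $\alpha\ge12.05$ for rule 3. There are $c,C>0$ depending only on the rule and on $\alpha$ such that in every setting as above with $m_0>1$, for every $\epsilon\in(0,\frac14]$ and every $N=LM\ge Lm_0$, $$\mathrm{Risk}_{\|\cdot\|,\epsilon}(\overline y_N|\mathcal X)\le\sqrt{2s}\,\mathrm{Risk}_{\|\cdot\|_2,\epsilon}(\overline y_N|\mathcal X)\le2\sqrt{2s}\,\mathrm{Risk}_{\|\cdot\|_2,\epsilon}(\overline x_N|\mathcal X)$$ $$\le C\left(R\exp\left\{-\frac{cN\kappa}{\Theta\varkappa\bar s\nu\ln(1/\epsilon)}\right\}+\frac{\varsigma_*\bar s}{\kappa}\sqrt{\frac{\Theta\varkappa'\ln(1/\epsilon)}{N}}\right).$$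 -/

import Mathlib

open MeasureTheory
open scoped ENNReal

noncomputable section

namespace SMDSR

universe u v

/-- The conjugate norm `max {⟨w, x⟩ : p x ≤ 1}` of a norm `p` on a Euclidean space. -/
def dualNorm {E : Type v} [NormedAddCommGroup E] [InnerProductSpace ℝ E]
    (p : Seminorm ℝ E) (w : E) : ℝ :=
  sSup ((fun x : E => inner ℝ w x) '' {x : E | p x ≤ 1})

/-- A sparsity structure: a family of linear projectors with nonnegative weights. -/
structure SparsityStructure (E : Type v) [NormedAddCommGroup E] [InnerProductSpace ℝ E] where
  projectors : Set (E →ₗ[ℝ] E)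
  weight : (E →ₗ[ℝ] E) → ℝ
  idempotent : ∀ P ∈ projectors, P ∘ₗ P = P
  weight_nonneg : ∀ P ∈ projectors, 0 ≤ weight P

/-- `x` is `s`-sparse: it is fixed by a projector of weight at most `s`. -/
def SparsityStructure.IsSparse {E : Type v} [NormedAddCommGroup E] [InnerProductSpace ℝ E]
    (𝒮 : SparsityStructure E) (s : ℝ) (x : E) : Prop :=
  ∃ P ∈ 𝒮.projectors, 𝒮.weight P ≤ s ∧ P x = x

/-- Everything that is known to the algorithm and that fixes the class of problems.
The norm of `E` itself is the Euclidean norm `‖·‖₂`; `nrm` is the other norm. -/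
structure Setting (E : Type v) [NormedAddCommGroup E] [InnerProductSpace ℝ E] where
  /-- the norm `‖·‖` -/
  nrm : Seminorm ℝ E
  /-- the domain -/
  X : Set E
  /-- the sparsity structure -/
  𝒮 : SparsityStructure E
  /-- the sparsification map -/
  sparse : E → E
  /-- the distance-generating function -/
  ϑ : E → ℝ
  /-- the constant of quadratic growth of `ϑ` -/
  Θ : ℝ
  /-- the Lipschitz constant of the gradient of the objective -/
  𝓛 : ℝ
  /-- the constant of quadratic growth of the objective -/
  κ : ℝ
  ν : ℝ
  ϰ : ℝ
  ϰ' : ℝ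
  /-- (bound for) the noise level at the optimal solution -/
  ς : ℝ
  /-- the sparsity of the optimal solution -/
  s : ℝ
  /-- the known upper bound for `s` -/
  sbar : ℝ
  /-- the starting point -/
  x₀ : E
  /-- the bound for the distance from the starting point to the optimal solution -/
  R : ℝ

/-- The standing assumptions on the data of `Setting`. -/
structure Setting.Standing {E : Type v} [NormedAddCommGroup E] [InnerProductSpace ℝ E]
    [CompleteSpace E] [MeasurableSpace E] (S : Setting E) : Prop where
  nrm_definite : ∀ x : E, S.nrm x = 0 → x = 0
  convex : Convex ℝ S.X
  closed : IsClosed S.X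
  solid : (interior S.X).Nonempty
  start_mem : S.x₀ ∈ S.X
  lip_nonneg : 0 ≤ S.𝓛
  lip_le : S.𝓛 ≤ S.ν
  κ_pos : 0 < S.κ
  one_le_ϰ : 1 ≤ S.ϰ
  one_le_ϰ' : 1 ≤ S.ϰ'
  ς_nonneg : 0 ≤ S.ς
  s_nonneg : 0 ≤ S.s
  s_le : S.s ≤ S.sbar
  ϑ_contDiff : ContDiff ℝ 1 S.ϑ
  ϑ_convex : ConvexOn ℝ Set.univ S.ϑ
  ϑ_strong : ∀ x x' : E, S.nrm (x - x') ^ 2 ≤ inner ℝ (gradient S.ϑ x - gradient S.ϑ x') (x - x')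
  ϑ_zero : S.ϑ 0 = 0
  ϑ_nonneg : ∀ x, 0 ≤ S.ϑ x
  ϑ_growth : ∀ x, S.ϑ x ≤ S.Θ * S.nrm x ^ 2
  /-- This follows from the preceding fields unless `E` is the zero space. -/
  half_le_Θ : 1 / 2 ≤ S.Θ
  /-- `sparse x` minimizes `‖x - z‖₂` over the `s`-sparse `z ∈ X`. -/
  sparse_mem : ∀ x ∈ S.X, S.sparse x ∈ S.X
  sparse_sparse : ∀ x ∈ S.X, S.𝒮.IsSparse S.s (S.sparse x)
  sparse_min : ∀ x ∈ S.X, ∀ z ∈ S.X, S.𝒮.IsSparse S.s z → ‖x - S.sparse x‖ ≤ ‖x - z‖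
  sparse_measurable : Measurable fun x : S.X => S.sparse x
  nrm_le : ∀ t : ℝ, 0 ≤ t → ∀ z : E, S.𝒮.IsSparse t z → S.nrm z ≤ √t * ‖z‖
  sparse_sub : ∀ z z' : E, S.𝒮.IsSparse S.s z → S.𝒮.IsSparse S.s z' →
    S.𝒮.IsSparse (2 * S.s) (z - z')

/-- A stochastic optimization problem: the law `P` of `ω` on a probability space `Ω`,
the integrand `G`, and the optimal solution. -/
structure Problem (E : Type v) where
  Ω : Type u
  [mΩ : MeasurableSpace Ω]
  P : Measure Ω
  [prob : IsProbabilityMeasure P]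
  G : E → Ω → ℝ
  xstar : E

attribute [instance] Problem.mΩ Problem.prob

/-- The expected objective. -/
def Problem.g {E : Type v} (Q : Problem.{u} E) (x : E) : ℝ := ∫ ω, Q.G x ω ∂Q.P

section

variable {E : Type v} [NormedAddCommGroup E] [InnerProductSpace ℝ E] [CompleteSpace E]

/-- The gradient of the objective on `X` (one-sided at the boundary of the solid `X`). -/
def Setting.gradg (S : Setting E) (Q : Problem.{u} E) (x : E) : E :=
  gradientWithin Q.g S.X x

/-- The stochastic gradient `∇G(x, ω)` on `X`. -/
def Setting.gradG (S : Setting E) (Q : Problem.{u} E) (x : E) (ω : Q.Ω) : E :=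
  gradientWithin (fun z => Q.G z ω) S.X x

/-- The oracle error. -/
def Setting.noise (S : Setting E) (Q : Problem.{u} E) (x : E) (ω : Q.Ω) : E :=
  S.gradG Q x ω - S.gradg Q x

/-- The problem `Q` belongs to the class given by the data `S`. Quadratic growth makes the optimal
solution unique. -/
structure Setting.InClass [MeasurableSpace E] (S : Setting E) (Q : Problem.{u} E) : Prop where
  integrable : ∀ x ∈ S.X, Integrable (Q.G x) Q.P
  convex : ConvexOn ℝ S.X Q.g
  differentiable : DifferentiableOn ℝ Q.g S.X
  lipschitz : ∀ x ∈ S.X, ∀ x' ∈ S.X,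
    dualNorm S.nrm (S.gradg Q x' - S.gradg Q x) ≤ S.𝓛 * S.nrm (x - x')
  xstar_mem : Q.xstar ∈ S.X
  xstar_min : IsMinOn Q.g S.X Q.xstar
  growth : ∀ x ∈ S.X, S.κ / 2 * ‖x - Q.xstar‖ ^ 2 ≤ Q.g x - Q.g Q.xstar
  xstar_sparse : S.𝒮.IsSparse S.s Q.xstar
  xstar_near : S.nrm (Q.xstar - S.x₀) ≤ S.R
  differentiable_G : ∀ᵐ ω ∂Q.P, DifferentiableOn ℝ (fun x => Q.G x ω) S.X
  measurable_gradG : Measurable fun z : S.X × Q.Ω => S.gradG Q z.1 z.2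
  integrable_gradG : ∀ x ∈ S.X, Integrable (S.gradG Q x) Q.P
  unbiased : ∀ x ∈ S.X, ∫ ω, S.gradG Q x ω ∂Q.P = S.gradg Q x
  integrable_noise : ∀ x ∈ S.X, Integrable (fun ω => dualNorm S.nrm (S.noise Q x ω) ^ 2) Q.P
  variance_star : ∫ ω, dualNorm S.nrm (S.noise Q Q.xstar ω) ^ 2 ∂Q.P ≤ S.ς ^ 2
  variance : ∀ x ∈ S.X, ∫ ω, dualNorm S.nrm (S.noise Q x ω) ^ 2 ∂Q.P ≤
    S.ϰ * S.ν * (Q.g x - Q.g Q.xstar - inner ℝ (S.gradg Q Q.xstar) (x - Q.xstar))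
      + S.ϰ' * S.ς ^ 2

/-- The class of problems. -/
def Setting.problems [MeasurableSpace E] (S : Setting E) : Set (Problem.{u} E) :=
  {Q | S.InClass Q}

/-! ### Stochastic mirror descent -/

/-- The Bregman divergence `V_{y}(x, z)`. -/
def Setting.bregman (S : Setting E) (y x z : E) : ℝ :=
  S.ϑ (z - y) - S.ϑ (x - y) - inner ℝ (gradient S.ϑ (x - y)) (z - x)

/-- The proximal mapping: the minimizer over `X` of `⟨w, z⟩ + β V_y(x, z)`. -/
def Setting.prox (S : Setting E) (β : ℝ) (w x y : E) : E :=
  Classical.epsilon fun z =>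
    z ∈ S.X ∧ IsMinOn (fun z' => inner ℝ w z' + β * S.bregman y x z') S.X z

/-- The mirror descent recursion started at `y`; `H i x` is the answer of the oracle to its
query number `i` (counted from `0`) at the point `x`. -/
def Setting.path (S : Setting E) (β : ℝ) (y : E) (H : ℕ → E → E) : ℕ → E
  | 0 => y
  | i + 1 => S.prox β (H i (S.path β y H i)) (S.path β y H i) y

/-- The approximate solution `x̂_m(y, β)`: the average of `m` mirror descent iterates. -/
def Setting.smd (S : Setting E) (β : ℝ) (m : ℕ) (y : E) (H : ℕ → E → E) : E :=
  (m : ℝ)⁻¹ • ∑ i ∈ Finset.range m, S.path β y H (i + 1)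

/-! ### The multistage algorithm -/

/-- Length of a preliminary stage. -/
def Setting.m₀ (S : Setting E) : ℕ :=
  ⌈16 * S.κ⁻¹ * S.sbar * (8 * S.Θ * S.ϰ + 1) * S.ν⌉₊

/-- Length of the asymptotic stage number `k ≥ 1`. -/
def Setting.m (S : Setting E) (k : ℕ) : ℕ :=
  ⌈512 * (S.sbar * S.Θ * S.ν * S.ϰ / S.κ) * 2 ^ k⌉₊

/-- The maximal number of preliminary stages, for `ς ≠ 0`; at least one stage is always run. -/
def Setting.Kbar (S : Setting E) : ℕ :=
  max 1 ⌈Real.logb 2 (S.R ^ 2 * S.κ * S.ν * S.ϰ / (32 * S.ς ^ 2 * S.sbar * S.ϰ'))⌉₊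

open Classical in
/-- The number of preliminary stages with `N` observations; the maximal number of
preliminary stages is infinite if `ς = 0`. -/
def Setting.K (S : Setting E) (N : ℕ) : ℕ :=
  if S.ς = 0 then N / S.m₀ else min (N / S.m₀) S.Kbar

/-- The pair `(x̂_{m₀}(y_{k-1}, β₀), y_k)` after `k` preliminary stages. -/
def Setting.prelim (S : Setting E) (H : ℕ → E → E) : ℕ → E × E
  | 0 => (S.x₀, S.x₀)
  | k + 1 =>
    let x := S.smd (2 * S.ϰ * S.ν) S.m₀ (S.prelim H k).2 (fun i => H (k * S.m₀ + i))
    (x, S.sparse x)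

/-- The pair `(x̂_{m_k}(y'_{k-1}, β_k), y'_k)` after `k` asymptotic stages. -/
def Setting.asymp (S : Setting E) (N : ℕ) (H : ℕ → E → E) : ℕ → E × E
  | 0 => S.prelim H (S.K N)
  | k + 1 =>
    let x := S.smd (2 ^ (k + 1) * S.ν * S.ϰ) (S.m (k + 1)) (S.asymp N H k).2
      (fun i => H (S.K N * S.m₀ + ∑ j ∈ Finset.Icc 1 k, S.m j + i))
    (x, S.sparse x)

/-- The number of asymptotic stages that fit into `M` observations. -/
def Setting.K' (S : Setting E) (M : ℕ) : ℕ :=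
  Nat.findGreatest (fun k => ∑ j ∈ Finset.Icc 1 k, S.m j ≤ M) M

open Classical in
/-- The output `(x̂_N, ŷ_N)` of the algorithm after `N` oracle queries. -/
def Setting.smdSR (S : Setting E) (N : ℕ) (H : ℕ → E → E) : E × E :=
  if S.ς ≠ 0 ∧ S.m₀ * S.Kbar + S.m 1 ≤ N then
    S.asymp N H (S.K' (N - S.m₀ * S.Kbar))
  else
    S.prelim H (S.K N)

/-- The stochastic oracle that uses the observations `w`; the algorithm with `M` observations
never makes a query with number `M` or more. -/
def Setting.oracle (S : Setting E) (Q : Problem.{u} E) {M : ℕ} (w : Fin M → Q.Ω) :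
    ℕ → E → E :=
  fun i x => if h : i < M then S.gradG Q x (w ⟨i, h⟩) else 0

/-- The solution `x̂_M` computed from the `M` observations `w`. -/
def Setting.xhat (S : Setting E) (Q : Problem.{u} E) {M : ℕ} (w : Fin M → Q.Ω) : E :=
  (S.smdSR M (S.oracle Q w)).1

end

/-! ### Aggregation -/

/-- The three aggregation rules. -/
inductive Rule
  /-- the geometric median -/
  | geometric
  /-- the geometric median over the given points -/
  | empirical
  /-- the point for which the upper median of the distances to the other points is smallest -/
  | distance

/-- The numeric constants of the three rules. -/
def Rule.α₀ : Rule → ℝ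
  | .geometric => 10
  | .empirical => 58.46
  | .distance => 12.05

section

variable {E : Type v} [NormedAddCommGroup E]

/-- The `k`-th order statistic of the distances from `z i` to the points `z j`, `j ≠ i`: the
smallest `t` such that at least `k` of these distances are at most `t`. -/
def orderStat {L : ℕ} (z : Fin L → E) (i : Fin L) (k : ℕ) : ℝ :=
  sInf {t : ℝ | k ≤ Set.ncard {j : Fin L | j ≠ i ∧ ‖z i - z j‖ ≤ t}}

/-- `x` is an output of the aggregation rule for the points `z`. -/
def Rule.IsOutput {L : ℕ} (z : Fin L → E) (x : E) : Rule → Prop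
  | .geometric => IsMinOn (fun y => ∑ l, ‖y - z l‖) Set.univ x
  | .empirical => x ∈ Set.range z ∧ IsMinOn (fun y => ∑ l, ‖y - z l‖) (Set.range z) x
  | .distance => ∃ i, x = z i ∧ ∀ j, orderStat z i (L / 2 + 1) ≤ orderStat z j (L / 2 + 1)

end

/-! ### Risk -/

/-- An estimator that uses `L` samples of length `M`. -/
def Estimator (E : Type v) (L M : ℕ) : Type (max (u + 1) v) :=
  (Q : Problem.{u} E) → (Fin L → Fin M → Q.Ω) → E

/-- The law of `L` independent samples, each of `M` independent observations. -/
def Problem.sampleLaw {E : Type v} (Q : Problem.{u} E) (L M : ℕ) :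
    Measure (Fin L → Fin M → Q.Ω) :=
  Measure.pi fun _ => Measure.pi fun _ => Q.P

/-- The `ε`-risk of an estimator over the class `𝒳` for the norm `q`:
`inf {r ≥ 0 : sup_𝒳 Prob {q (x̂ - x_*) ≥ r} ≤ ε}`. -/
def epsRisk {E : Type v} [NormedAddCommGroup E] {L M : ℕ} (q : E → ℝ) (ε : ℝ)
    (𝒳 : Set (Problem.{u} E)) (est : Estimator.{u} E L M) : ℝ≥0∞ :=
  sInf {r : ℝ≥0∞ | ⨆ Q ∈ 𝒳,
    Q.sampleLaw L M {w | r ≤ ENNReal.ofReal (q (est Q w - Q.xstar))} ≤ ENNReal.ofReal ε}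

end SMDSR

end

noncomputable section

namespace SMDSR

universe u v

/-! ### The norm and its conjugate -/

section Norms

variable {E : Type v} [NormedAddCommGroup E] [InnerProductSpace ℝ E] [FiniteDimensional ℝ E]

/-! Let ζ be the oracle error at x. One step of mirror descent from x to x⁺ satisfies g(x⁺) − g(x_*)
+ βV(x⁺, x_*) ≤ βV(x, x_*) + ⟨ζ, x_* − x⟩ + ‖ζ‖_*²/β (`prox_step_le`). In the mean the linear term
vanishes. For β ≥ 2ϰν the part of the variance that depends on x costs at most half of the gap g(x)
− g(x_*), which stands on the left side of the previous step. The sum over a stage therefore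
telescopes. Convexity and quadratic growth turn it into a bound for the Euclidean error of the
average in terms of the error of the starting point in the other norm (`lintegral_stageOut_le`).
Sparsification leads back to the other norm, and the squared error grows by a factor 8s̄
(`nrm_sparse_sub_sq_le`).

Each stage thus acts on the error bound ρ as an affine contraction. With A = `noiseFloor` and T =
`stageCost`, a preliminary stage is ρ ↦ ρ/2 + A/2, which gives 2⁻ᵏR² + A. The asymptotic stage k is
ρ ↦ ρ/4 + 2⁻ᵏA, which keeps ρ ≤ 4·2⁻ᵏA. The lengths are of order T and 2ᵏT. Either the preliminary
stages use a fixed fraction of the M observations and the error is exponentially small in M/T, or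
2⁻ᵏ is of order T/M. Since AT = 32ς²s̄²Θϰ'/κ², this is the claimed rate (`exists_hasError_smdSR`).

Finally, Markov's inequality makes a single run inaccurate with probability at most 1/1000. At least
a third of L independent runs are inaccurate with probability at most 5⁻ᴸ ≤ ε
(`measure_pi_many_mem_le`). If fewer are, each rule returns a point at most 8 times less accurate
(`Rule.IsOutput.norm_sub_lt`). -/

lemma seminorm_continuous (p : Seminorm ℝ E) : Continuous p := by
  have h := p.convexOn.continuousOn isOpen_univ
  exact continuousOn_univ.mp h

/-- By compactness, a definite seminorm has a positive minimum on the Euclidean unit sphere. This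
makes the conjugate norm finite and the proximal objective coercive. -/
lemma exists_norm_le_mul_seminorm (p : Seminorm ℝ E) (hp : ∀ x, p x = 0 → x = 0) :
    ∃ c : ℝ, 0 < c ∧ ∀ x, ‖x‖ ≤ c * p x := by
  rcases subsingleton_or_nontrivial E with hE | hE
  · exact ⟨1, one_pos, fun x => by simp [Subsingleton.elim x 0]⟩
  obtain ⟨u, hu, hmin⟩ := (isCompact_sphere (0 : E) 1).exists_isMinOn
    (NormedSpace.sphere_nonempty.mpr zero_le_one) (seminorm_continuous p).continuousOn
  have hu1 : ‖u‖ = 1 := by simpa using hu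
  have hpu : 0 < p u := by
    refine lt_of_le_of_ne (apply_nonneg p u) fun h => ?_
    rw [hp u h.symm] at hu1
    simp at hu1
  refine ⟨(p u)⁻¹, inv_pos.mpr hpu, fun x => ?_⟩
  rcases eq_or_ne x 0 with rfl | hx
  · simp
  have hx' : 0 < ‖x‖ := norm_pos_iff.mpr hx
  have h1 : p u ≤ p (‖x‖⁻¹ • x) := hmin (by simp [norm_smul, hx'.ne'])
  rw [map_smul_eq_mul, norm_inv, norm_norm, inv_mul_eq_div, le_div_iff₀ hx'] at h1
  rw [inv_mul_eq_div, le_div_iff₀ hpu]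
  linarith

variable {p : Seminorm ℝ E}

lemma dualNorm_bddAbove (hp : ∀ x, p x = 0 → x = 0) (w : E) :
    BddAbove ((fun x : E => inner ℝ w x) '' {x : E | p x ≤ 1}) := by
  obtain ⟨c, hc, h⟩ := exists_norm_le_mul_seminorm p hp
  refine ⟨‖w‖ * c, ?_⟩
  rintro _ ⟨x, hx, rfl⟩
  refine (real_inner_le_norm w x).trans (mul_le_mul_of_nonneg_left ?_ (norm_nonneg w))
  exact (h x).trans (mul_le_of_le_one_right hc.le hx)

lemma inner_le_dualNorm_mul (hp : ∀ x, p x = 0 → x = 0) (w x : E) :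
    inner ℝ w x ≤ dualNorm p w * p x := by
  rcases eq_or_ne (p x) 0 with h0 | h0
  · simp [hp x h0]
  have hpos : 0 < p x := lt_of_le_of_ne (apply_nonneg p x) h0.symm
  have h1 : inner ℝ w ((p x)⁻¹ • x) ≤ dualNorm p w := by
    refine le_csSup (dualNorm_bddAbove hp w) ⟨_, ?_, rfl⟩
    simp [map_smul_eq_mul, h0, abs_of_pos hpos]
  rw [inner_smul_right, inv_mul_eq_div, div_le_iff₀ hpos] at h1
  exact h1

end Norms

/-! ### First-order inequalities on convex sets -/

section FirstOrder

variable {E : Type v} [NormedAddCommGroup E] [InnerProductSpace ℝ E] [CompleteSpace E]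
  {f : E → ℝ} {D : E → E} {X : Set E}

lemma hasDerivWithinAt_segment (hX : Convex ℝ X)
    (hf : ∀ x ∈ X, HasGradientWithinAt f (D x) X x) {x z : E} (hx : x ∈ X) (hz : z ∈ X)
    {t : ℝ} (ht : t ∈ Set.Icc (0 : ℝ) 1) :
    HasDerivWithinAt (fun t : ℝ => f (x + t • (z - x))) (inner ℝ (D (x + t • (z - x))) (z - x))
      (Set.Icc 0 1) t := by
  have hmem : ∀ s ∈ Set.Icc (0 : ℝ) 1, x + s • (z - x) ∈ X := fun s hs =>
    hX.add_smul_sub_mem hx hz hs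
  have h1 := (hf _ (hmem t ht)).hasFDerivWithinAt
  have h2 : HasDerivWithinAt (fun t : ℝ => x + t • (z - x)) (z - x) (Set.Icc 0 1) t := by
    have := ((hasDerivAt_id t).smul_const (z - x)).const_add x
    simpa using this.hasDerivWithinAt
  exact h1.comp_hasDerivWithinAt t h2 hmem

/-- Along the segment, f minus the claimed quadratic has nonpositive derivative. Gradients within X
suffice, because the restriction to the segment is differentiable in the interior of [0, 1]. -/
lemma le_of_gradient_growth_le (hX : Convex ℝ X)
    (hf : ∀ x ∈ X, HasGradientWithinAt f (D x) X x) {x z : E} (hx : x ∈ X) (hz : z ∈ X) {c : ℝ}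
    (hc : ∀ t ∈ Set.Icc (0 : ℝ) 1,
      inner ℝ (D (x + t • (z - x)) - D x) (z - x) ≤ t * c) :
    f z ≤ f x + inner ℝ (D x) (z - x) + c / 2 := by
  have hd : ∀ t ∈ Set.Icc (0 : ℝ) 1, HasDerivWithinAt
      (fun t : ℝ => f (x + t • (z - x)) - (t * inner ℝ (D x) (z - x) + t ^ 2 * (c / 2)))
      (inner ℝ (D (x + t • (z - x))) (z - x) - (inner ℝ (D x) (z - x) + t * c))
      (Set.Icc 0 1) t := fun t ht => by
    refine (hasDerivWithinAt_segment hX hf hx hz ht).sub (HasDerivAt.hasDerivWithinAt ?_)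
    have h1 := (hasDerivAt_id' t).mul_const (inner ℝ (D x) (z - x))
    have h2 := (hasDerivAt_pow 2 t).mul_const (c / 2)
    refine (h1.add h2).congr_deriv ?_
    push_cast
    ring
  have hanti := antitoneOn_of_deriv_nonpos (convex_Icc (0 : ℝ) 1)
    (fun t ht => (hd t ht).continuousWithinAt)
    (fun t ht => ((hd t (interior_subset ht)).differentiableWithinAt).mono interior_subset)
    (fun t ht => by
      have ht' := interior_subset ht
      rw [((hd t ht').hasDerivAt (mem_interior_iff_mem_nhds.mp ht)).deriv]
      have := hc t ht'
      rw [inner_sub_left] at this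
      linarith)
  have h := hanti (Set.left_mem_Icc.mpr zero_le_one) (Set.right_mem_Icc.mpr zero_le_one)
    zero_le_one
  simp at h
  linarith

lemma le_of_le_gradient_growth (hX : Convex ℝ X)
    (hf : ∀ x ∈ X, HasGradientWithinAt f (D x) X x) {x z : E} (hx : x ∈ X) (hz : z ∈ X) {c : ℝ}
    (hc : ∀ t ∈ Set.Icc (0 : ℝ) 1,
      t * c ≤ inner ℝ (D (x + t • (z - x)) - D x) (z - x)) :
    f x + inner ℝ (D x) (z - x) + c / 2 ≤ f z := by
  have hneg : ∀ x ∈ X, HasGradientWithinAt (fun y => -f y) (-D x) X x := fun x hx => by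
    rw [hasGradientWithinAt_iff_hasFDerivWithinAt, map_neg]
    exact (hf x hx).hasFDerivWithinAt.neg
  have h := le_of_gradient_growth_le (D := fun y => -D y) (c := -c) hX hneg hx hz fun t ht => by
    have := hc t ht
    rw [inner_sub_left] at this ⊢
    rw [inner_neg_left, inner_neg_left]
    linarith
  rw [inner_neg_left] at h
  linarith

lemma inner_gradient_le_sub (hX : Convex ℝ X) (hconv : ConvexOn ℝ X f)
    (hf : ∀ x ∈ X, HasGradientWithinAt f (D x) X x) {x z : E} (hx : x ∈ X) (hz : z ∈ X) :
    inner ℝ (D x) (z - x) ≤ f z - f x := by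
  have hd := hasDerivWithinAt_segment hX hf hx hz (Set.left_mem_Icc.mpr zero_le_one)
  have hc : ConvexOn ℝ (Set.Icc (0 : ℝ) 1) (fun t : ℝ => f (x + t • (z - x))) := by
    have h := hconv.comp_affineMap (AffineMap.lineMap x z : ℝ →ᵃ[ℝ] E)
    have h' := h.subset (s := Set.Icc (0 : ℝ) 1) (fun t ht => by
      simpa [AffineMap.lineMap_apply, add_comm] using hX.add_smul_sub_mem hx hz ht)
      (convex_Icc 0 1)
    refine h'.congr fun t _ => ?_
    simp [AffineMap.lineMap_apply, add_comm]
  have := hc.le_slope_of_hasDerivWithinAt (Set.left_mem_Icc.mpr zero_le_one)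
    (Set.right_mem_Icc.mpr zero_le_one) zero_lt_one hd
  simpa [slope] using this

lemma inner_gradient_nonneg_of_isMinOn (hX : Convex ℝ X) {x z g : E}
    (hf : HasGradientWithinAt f g X x) (hmin : IsMinOn f X x) (hx : x ∈ X) (hz : z ∈ X) :
    0 ≤ inner ℝ g (z - x) := by
  have h := hmin.localize.hasFDerivWithinAt_nonneg hf.hasFDerivWithinAt
    (sub_mem_posTangentConeAt_of_segment_subset (hX.segment_subset hx hz))
  simpa [InnerProductSpace.toDual_apply_apply] using h

end FirstOrder

/-! ### The proximal mapping -/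

section Prox

variable {E : Type v} [NormedAddCommGroup E] [InnerProductSpace ℝ E] [CompleteSpace E]
  [MeasurableSpace E] {S : Setting E}

namespace Setting.Standing

lemma hasGradientAt (hS : S.Standing) (x : E) : HasGradientAt S.ϑ (gradient S.ϑ x) x :=
  (hS.ϑ_contDiff.differentiable one_ne_zero x).hasGradientAt

lemma continuous_gradient (hS : S.Standing) : Continuous (gradient S.ϑ) :=
  (InnerProductSpace.toDual ℝ E).symm.continuous.comp
    (hS.ϑ_contDiff.continuous_fderiv one_ne_zero)

lemma gradient_zero (hS : S.Standing) : gradient S.ϑ 0 = 0 := by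
  have hmin : IsLocalMin S.ϑ 0 :=
    Filter.Eventually.of_forall fun x => by rw [hS.ϑ_zero]; exact hS.ϑ_nonneg x
  have h := hmin.fderiv_eq_zero
  rw [gradient, h, map_zero]

lemma half_sq_le_bregman (hS : S.Standing) (y x z : E) :
    S.nrm (z - x) ^ 2 / 2 ≤ S.bregman y x z := by
  have h := le_of_le_gradient_growth (f := S.ϑ) (D := gradient S.ϑ) (X := Set.univ)
    (x := x - y) (z := z - y) (c := S.nrm (z - x) ^ 2) convex_univ
    (fun x _ => hasGradientWithinAt_univ.mpr (hS.hasGradientAt x)) trivial trivial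
    fun t ht => by
      have hd : z - y - (x - y) = z - x := by abel
      rw [hd]
      -- Strong monotonicity gives the claim multiplied by t, so t = 0 is treated apart.
      rcases ht.1.eq_or_lt with rfl | ht0
      · simp
      have h1 := hS.ϑ_strong (x - y + t • (z - x)) (x - y)
      rw [add_sub_cancel_left, map_smul_eq_mul, inner_smul_right, Real.norm_of_nonneg ht.1] at h1
      refine le_of_mul_le_mul_left ?_ ht0
      calc t * (t * S.nrm (z - x) ^ 2) = (t * S.nrm (z - x)) ^ 2 := by ring
        _ ≤ _ := h1
  have hd : z - y - (x - y) = z - x := by abel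
  rw [hd] at h
  rw [Setting.bregman]
  linarith

lemma bregman_nonneg (hS : S.Standing) (y x z : E) : 0 ≤ S.bregman y x z :=
  (by positivity : (0 : ℝ) ≤ S.nrm (z - x) ^ 2 / 2).trans (hS.half_sq_le_bregman y x z)

lemma bregman_start_le (hS : S.Standing) (y z : E) :
    S.bregman y y z ≤ S.Θ * S.nrm (z - y) ^ 2 := by
  rw [Setting.bregman, sub_self, hS.gradient_zero, hS.ϑ_zero, inner_zero_left, sub_zero, sub_zero]
  exact hS.ϑ_growth _

lemma continuous_bregman (hS : S.Standing) :
    Continuous fun q : E × E × E => S.bregman q.1 q.2.1 q.2.2 := by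
  have h1 := hS.ϑ_contDiff.continuous
  have h2 := hS.continuous_gradient
  unfold Setting.bregman
  fun_prop

lemma hasGradientAt_prox_objective (hS : S.Standing) (β : ℝ) (w x y z : E) :
    HasGradientAt (fun z' => inner ℝ w z' + β * S.bregman y x z')
      (w + β • (gradient S.ϑ (z - y) - gradient S.ϑ (x - y))) z := by
  rw [hasGradientAt_iff_hasFDerivAt]
  have h1 : HasFDerivAt (fun z' : E => inner ℝ w z') (InnerProductSpace.toDual ℝ E w) z :=
    (InnerProductSpace.toDual ℝ E w).hasFDerivAt
  have h2 : HasFDerivAt (fun z' : E => S.ϑ (z' - y))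
      (InnerProductSpace.toDual ℝ E (gradient S.ϑ (z - y))) z := by
    have h := (hS.hasGradientAt (z - y)).hasFDerivAt
    exact h.comp z ((hasFDerivAt_id z).sub_const y)
  have h3 : HasFDerivAt (fun z' : E => inner ℝ (gradient S.ϑ (x - y)) (z' - x))
      (InnerProductSpace.toDual ℝ E (gradient S.ϑ (x - y))) z := by
    have h := (InnerProductSpace.toDual ℝ E (gradient S.ϑ (x - y))).hasFDerivAt (x := z - x)
    exact h.comp z ((hasFDerivAt_id z).sub_const x)
  have h4 := h1.add ((((h2.sub_const (S.ϑ (x - y))).sub h3)).const_mul β)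
  rw [map_add, map_smulₛₗ, map_sub]
  exact h4

variable [FiniteDimensional ℝ E]

lemma exists_prox (hS : S.Standing) {β : ℝ} (hβ : 0 < β) (w x y : E) :
    ∃ z, z ∈ S.X ∧ IsMinOn (fun z' => inner ℝ w z' + β * S.bregman y x z') S.X z := by
  obtain ⟨c, hc, hcn⟩ := exists_norm_le_mul_seminorm S.nrm hS.nrm_definite
  set φ : E → ℝ := fun z' => inner ℝ w z' + β * S.bregman y x z' with hφ
  have hcont : Continuous φ := by
    have h := hS.continuous_bregman.comp (f := fun z' : E => (y, x, z')) (by fun_prop)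
    exact (continuous_const.inner continuous_id).add (continuous_const.mul h)
  set k : ℝ := β / (2 * c ^ 2) with hk
  have hk0 : 0 < k := by positivity
  have hlow : ∀ z, k * ‖z - x‖ ^ 2 - ‖w‖ * ‖z - x‖ - ‖w‖ * ‖x‖ ≤ φ z := fun z => by
    have h1 := hS.half_sq_le_bregman y x z
    have h2 : ‖z - x‖ ^ 2 ≤ c ^ 2 * S.nrm (z - x) ^ 2 := by
      rw [← mul_pow]; exact pow_le_pow_left₀ (norm_nonneg _) (hcn _) 2
    have h3 : k * ‖z - x‖ ^ 2 ≤ β * S.bregman y x z := by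
      calc k * ‖z - x‖ ^ 2 ≤ k * (c ^ 2 * S.nrm (z - x) ^ 2) := by gcongr
        _ = β * (S.nrm (z - x) ^ 2 / 2) := by rw [hk]; field_simp
        _ ≤ _ := by gcongr
    have h4 : -(‖w‖ * ‖z - x‖ + ‖w‖ * ‖x‖) ≤ inner ℝ w z := by
      have h5 := neg_le_of_abs_le (abs_real_inner_le_norm w z)
      have h6 : ‖z‖ ≤ ‖z - x‖ + ‖x‖ := by simpa using norm_add_le (z - x) x
      nlinarith [norm_nonneg w]
    simp only [hφ]
    linarith
  obtain ⟨x₁, hx₁⟩ : S.X.Nonempty := ⟨_, hS.start_mem⟩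
  refine hcont.continuousOn.exists_isMinOn' hS.closed hx₁
    (Filter.Eventually.filter_mono inf_le_left ?_)
  have htend : Filter.Tendsto (fun z : E => ‖z‖) (Filter.cocompact E) Filter.atTop :=
    tendsto_norm_cocompact_atTop
  -- The first entry of the maximum makes the quadratic term exceed (‖w‖ + 1)‖z − x‖, hence φ z ≥ ‖z
  -- − x‖ − ‖w‖‖x‖. By the second entry this is at least φ x₁.
  filter_upwards [htend.eventually_ge_atTop
    (‖x‖ + (max ((‖w‖ + 1) / k) (φ x₁ + ‖w‖ * ‖x‖)))] with z hz
  have hn : max ((‖w‖ + 1) / k) (φ x₁ + ‖w‖ * ‖x‖) ≤ ‖z - x‖ := by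
    have := norm_sub_norm_le z x
    linarith
  have h1 := (le_max_left _ _).trans hn
  have h2 := (le_max_right _ _).trans hn
  rw [div_le_iff₀ hk0] at h1
  have h3 := hlow z
  have h4 : (‖w‖ + 1) * ‖z - x‖ ≤ ‖z - x‖ * k * ‖z - x‖ := by gcongr
  nlinarith

lemma prox_spec (hS : S.Standing) {β : ℝ} (hβ : 0 < β) (w x y : E) :
    S.prox β w x y ∈ S.X ∧
      IsMinOn (fun z' => inner ℝ w z' + β * S.bregman y x z') S.X (S.prox β w x y) :=
  Classical.epsilon_spec (hS.exists_prox hβ w x y)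

lemma prox_mem (hS : S.Standing) {β : ℝ} (hβ : 0 < β) (w x y : E) : S.prox β w x y ∈ S.X :=
  (hS.prox_spec hβ w x y).1

lemma prox_variational (hS : S.Standing) {β : ℝ} (hβ : 0 < β) (w x y : E) {z : E}
    (hz : z ∈ S.X) :
    0 ≤ inner ℝ (w + β • (gradient S.ϑ (S.prox β w x y - y) - gradient S.ϑ (x - y)))
      (z - S.prox β w x y) :=
  inner_gradient_nonneg_of_isMinOn hS.convex
    (hS.hasGradientAt_prox_objective β w x y _).hasFDerivAt.hasFDerivWithinAt
    (hS.prox_spec hβ w x y).2 (hS.prox_mem hβ w x y) hz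

/-- The three Bregman divergences combine into an inner product with a difference of gradients of ϑ,
so this is the optimality condition of the proximal problem rewritten. -/
lemma prox_three_point (hS : S.Standing) {β : ℝ} (hβ : 0 < β) (w x y : E) {z : E}
    (hz : z ∈ S.X) :
    inner ℝ w (S.prox β w x y - z) ≤
      β * (S.bregman y x z - S.bregman y (S.prox β w x y) z - S.bregman y x (S.prox β w x y)) := by
  have h := hS.prox_variational hβ w x y hz
  set q := S.prox β w x y
  have e1 : inner ℝ (gradient S.ϑ (x - y)) (z - x) =
      inner ℝ (gradient S.ϑ (x - y)) (z - q) + inner ℝ (gradient S.ϑ (x - y)) (q - x) := by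
    rw [← inner_add_right]; congr 1; abel
  have e2 : inner ℝ w (q - z) = -inner ℝ w (z - q) := by rw [← inner_neg_right]; simp
  rw [inner_add_left, inner_smul_left, inner_sub_left] at h
  simp only [Setting.bregman, e1, e2]
  simp only [conj_trivial] at h
  linarith

/-- This is what makes the iterates measurable. Each of two minimizers is tested in the variational
inequality of the other; strong monotonicity of ∇ϑ then bounds their distance by the perturbation of
the data, which tends to zero. -/
lemma continuous_prox (hS : S.Standing) {β : ℝ} (hβ : 0 < β) :
    Continuous fun q : E × E × E => S.prox β q.1 q.2.1 q.2.2 := by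
  obtain ⟨c, hc, hcn⟩ := exists_norm_le_mul_seminorm S.nrm hS.nrm_definite
  have key : ∀ w x y w' x' y' : E, ‖S.prox β w' x' y' - S.prox β w x y‖ ≤ c ^ 2 / β *
      ‖(w - β • gradient S.ϑ (x - y)) - (w' - β • gradient S.ϑ (x' - y')) +
        β • (gradient S.ϑ (S.prox β w x y - y) - gradient S.ϑ (S.prox β w x y - y'))‖ := by
    intro w x y w' x' y'
    have h1 := hS.prox_variational hβ w x y (hS.prox_mem hβ w' x' y')
    have h2 := hS.prox_variational hβ w' x' y' (hS.prox_mem hβ w x y)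
    set q := S.prox β w x y
    set q' := S.prox β w' x' y'
    set r := (w - β • gradient S.ϑ (x - y)) - (w' - β • gradient S.ϑ (x' - y')) +
        β • (gradient S.ϑ (q - y) - gradient S.ϑ (q - y'))
    have h3 := hS.ϑ_strong (q' - y') (q - y')
    rw [sub_sub_sub_cancel_right] at h3
    have h4 : β * S.nrm (q' - q) ^ 2 ≤ inner ℝ r (q' - q) := by
      have e2 : q - q' = -(q' - q) := by abel
      rw [e2, inner_neg_right] at h2
      have e : inner ℝ r (q' - q) =
          inner ℝ (w + β • (gradient S.ϑ (q - y) - gradient S.ϑ (x - y))) (q' - q)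
          - inner ℝ (w' + β • (gradient S.ϑ (q' - y') - gradient S.ϑ (x' - y'))) (q' - q)
          + β * inner ℝ (gradient S.ϑ (q' - y') - gradient S.ϑ (q - y')) (q' - q) := by
        rw [← inner_sub_left, ← real_inner_smul_left, ← inner_add_left]
        congr 1
        simp only [r]
        module
      rw [e]
      have := mul_le_mul_of_nonneg_left h3 hβ.le
      linarith
    rcases (norm_nonneg (q' - q)).eq_or_lt with h0 | h0
    · rw [← h0]; positivity
    have h5 : ‖q' - q‖ ^ 2 ≤ c ^ 2 * S.nrm (q' - q) ^ 2 := by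
      rw [← mul_pow]; exact pow_le_pow_left₀ (norm_nonneg _) (hcn _) 2
    have h6 := h4.trans (real_inner_le_norm r (q' - q))
    rw [div_mul_eq_mul_div, le_div_iff₀ hβ]
    refine le_of_mul_le_mul_right ?_ h0
    calc ‖q' - q‖ * β * ‖q' - q‖ = β * ‖q' - q‖ ^ 2 := by ring
      _ ≤ β * (c ^ 2 * S.nrm (q' - q) ^ 2) := by gcongr
      _ = c ^ 2 * (β * S.nrm (q' - q) ^ 2) := by ring
      _ ≤ c ^ 2 * (‖r‖ * ‖q' - q‖) := by gcongr
      _ = _ := by ring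
  rw [continuous_iff_continuousAt]
  rintro ⟨w, x, y⟩
  rw [ContinuousAt, tendsto_iff_norm_sub_tendsto_zero]
  have hg := hS.continuous_gradient
  have hcont : Continuous fun q : E × E × E => c ^ 2 / β *
      ‖(w - β • gradient S.ϑ (x - y)) - (q.1 - β • gradient S.ϑ (q.2.1 - q.2.2)) +
        β • (gradient S.ϑ (S.prox β w x y - y) - gradient S.ϑ (S.prox β w x y - q.2.2))‖ := by
    fun_prop
  refine squeeze_zero (fun _ => norm_nonneg _) (fun q => key w x y q.1 q.2.1 q.2.2) ?_
  simpa using hcont.tendsto (w, x, y)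

end Setting.Standing

end Prox

/-! ### One step of mirror descent -/

section Step

variable {E : Type v} [NormedAddCommGroup E] [InnerProductSpace ℝ E] [CompleteSpace E]
  [MeasurableSpace E] {S : Setting E} {Q : Problem.{u} E}

/-- The Bregman divergence of the objective from the optimal solution. -/
def Setting.optBregman (S : Setting E) (Q : Problem.{u} E) (x : E) : ℝ :=
  Q.g x - Q.g Q.xstar - inner ℝ (S.gradg Q Q.xstar) (x - Q.xstar)

namespace Setting.InClass

lemma hasGradientWithinAt (hQ : S.InClass Q) (x : E) (hx : x ∈ S.X) :
    HasGradientWithinAt Q.g (S.gradg Q x) S.X x :=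
  (hQ.differentiable x hx).hasGradientWithinAt

lemma gap_nonneg (hQ : S.InClass Q) {x : E} (hx : x ∈ S.X) : 0 ≤ Q.g x - Q.g Q.xstar :=
  sub_nonneg.mpr (hQ.xstar_min hx)

lemma optBregman_nonneg (hS : S.Standing) (hQ : S.InClass Q) {x : E} (hx : x ∈ S.X) :
    0 ≤ S.optBregman Q x :=
  sub_nonneg.mpr (inner_gradient_le_sub hS.convex hQ.convex hQ.hasGradientWithinAt
    hQ.xstar_mem hx)

lemma optBregman_le_gap (hS : S.Standing) (hQ : S.InClass Q) {x : E} (hx : x ∈ S.X) :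
    S.optBregman Q x ≤ Q.g x - Q.g Q.xstar :=
  sub_le_self _ (inner_gradient_nonneg_of_isMinOn hS.convex
    (hQ.hasGradientWithinAt _ hQ.xstar_mem) hQ.xstar_min hQ.xstar_mem hx)

lemma integrable_noise_vec (hQ : S.InClass Q) {x : E} (hx : x ∈ S.X) :
    Integrable (S.noise Q x) Q.P :=
  (hQ.integrable_gradG x hx).sub (integrable_const _)

lemma integral_noise (hQ : S.InClass Q) {x : E} (hx : x ∈ S.X) :
    ∫ ω, S.noise Q x ω ∂Q.P = 0 := by
  have h := integral_sub (hQ.integrable_gradG x hx) (integrable_const (μ := Q.P) (S.gradg Q x))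
  rw [hQ.unbiased x hx] at h
  simpa [Setting.noise] using h

variable [FiniteDimensional ℝ E]

lemma objective_le (hS : S.Standing) (hQ : S.InClass Q) {x z : E} (hx : x ∈ S.X) (hz : z ∈ S.X) :
    Q.g z ≤ Q.g x + inner ℝ (S.gradg Q x) (z - x) + S.𝓛 * S.nrm (z - x) ^ 2 / 2 := by
  refine le_of_gradient_growth_le hS.convex hQ.hasGradientWithinAt hx hz fun t ht => ?_
  have hmem := hS.convex.add_smul_sub_mem hx hz ht
  refine (inner_le_dualNorm_mul hS.nrm_definite _ _).trans ?_
  have h := hQ.lipschitz x hx _ hmem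
  have e : S.nrm (x - (x + t • (z - x))) = t * S.nrm (z - x) := by
    rw [sub_add_cancel_left, map_neg_eq_map, map_smul_eq_mul, Real.norm_of_nonneg ht.1]
  rw [e] at h
  calc _ ≤ S.𝓛 * (t * S.nrm (z - x)) * S.nrm (z - x) := by gcongr
    _ = _ := by ring

lemma optBregman_le_nrm (hS : S.Standing) (hQ : S.InClass Q) {x : E} (hx : x ∈ S.X) :
    S.optBregman Q x ≤ S.ν / 2 * S.nrm (x - Q.xstar) ^ 2 := by
  have h := hQ.objective_le hS hQ.xstar_mem hx
  have h2 : S.𝓛 * S.nrm (x - Q.xstar) ^ 2 ≤ S.ν * S.nrm (x - Q.xstar) ^ 2 :=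
    mul_le_mul_of_nonneg_right hS.lip_le (by positivity)
  rw [Setting.optBregman]
  linarith

/-- The term β/2·‖q − x‖² supplied by the strong convexity of ϑ is split evenly. One half absorbs
the smoothness error, because β ≥ 2𝓛; the other absorbs ⟨ζ, x − q⟩ through Young's inequality. -/
lemma prox_step_le (hS : S.Standing) (hQ : S.InClass Q) {β : ℝ} (hβ : 0 < β)
    (hβν : 2 * S.ϰ * S.ν ≤ β) {x : E} (hx : x ∈ S.X) (y : E) (ω : Q.Ω) :
    Q.g (S.prox β (S.gradG Q x ω) x y) - Q.g Q.xstar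
        + β * S.bregman y (S.prox β (S.gradG Q x ω) x y) Q.xstar ≤
      β * S.bregman y x Q.xstar + inner ℝ (S.noise Q x ω) (Q.xstar - x)
        + dualNorm S.nrm (S.noise Q x ω) ^ 2 / β := by
  have h1 := hS.prox_three_point hβ (S.gradG Q x ω) x y hQ.xstar_mem
  have hq := hS.prox_mem hβ (S.gradG Q x ω) x y
  set q := S.prox β (S.gradG Q x ω) x y
  have h2 := hQ.objective_le hS hx hq
  have h3 := inner_gradient_le_sub hS.convex hQ.convex hQ.hasGradientWithinAt hx hQ.xstar_mem
  have h4 := hS.half_sq_le_bregman y x q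
  set d := dualNorm S.nrm (S.noise Q x ω) with hd
  have h5 : inner ℝ (S.noise Q x ω) (x - q) ≤ d * S.nrm (q - x) := by
    rw [← map_sub_rev]; exact inner_le_dualNorm_mul hS.nrm_definite _ _
  have hg : S.gradG Q x ω = S.gradg Q x + S.noise Q x ω := by simp [Setting.noise]
  have e1 : inner ℝ (S.gradG Q x ω) (q - Q.xstar) =
      inner ℝ (S.gradg Q x) (q - x) - inner ℝ (S.gradg Q x) (Q.xstar - x)
        - inner ℝ (S.noise Q x ω) (x - q) - inner ℝ (S.noise Q x ω) (Q.xstar - x) := by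
    rw [hg, inner_add_left]
    simp only [inner_sub_right]
    ring
  rw [e1] at h1
  have hν : 0 ≤ S.ν := hS.lip_nonneg.trans hS.lip_le
  have hL : 2 * S.𝓛 ≤ β := by
    have := mul_le_mul_of_nonneg_right hS.one_le_ϰ hν
    linarith [hS.lip_le]
  have h6 : d * S.nrm (q - x) ≤ d ^ 2 / β + β / 4 * S.nrm (q - x) ^ 2 := by
    have : 0 ≤ (d - β / 2 * S.nrm (q - x)) ^ 2 / β := by positivity
    have e : (d - β / 2 * S.nrm (q - x)) ^ 2 / β =
        d ^ 2 / β - d * S.nrm (q - x) + β / 4 * S.nrm (q - x) ^ 2 := by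
      field_simp
      ring
    linarith
  have h7 : S.𝓛 * S.nrm (q - x) ^ 2 / 2 ≤ β / 4 * S.nrm (q - x) ^ 2 := by
    have : 0 ≤ S.nrm (q - x) ^ 2 := by positivity
    nlinarith
  have h8 := mul_le_mul_of_nonneg_left h4 hβ.le
  linarith

/-- The noise has mean zero, and β ≥ 2ϰν turns the variance bound into `optBregman`/2 plus a
constant. Both summands on the left are nonnegative, so lower integrals avoid any integrability
question about the new iterate. -/
lemma lintegral_prox_step_le (hS : S.Standing) (hQ : S.InClass Q) {β : ℝ} (hβ : 0 < β)
    (hβν : 2 * S.ϰ * S.ν ≤ β) {x : E} (hx : x ∈ S.X) (y : E) :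
    ∫⁻ ω, (ENNReal.ofReal (Q.g (S.prox β (S.gradG Q x ω) x y) - Q.g Q.xstar)
        + ENNReal.ofReal (β * S.bregman y (S.prox β (S.gradG Q x ω) x y) Q.xstar)) ∂Q.P ≤
      ENNReal.ofReal (β * S.bregman y x Q.xstar) + ENNReal.ofReal (S.optBregman Q x / 2)
        + ENNReal.ofReal (S.ϰ' * S.ς ^ 2 / β) := by
  set h : Q.Ω → ℝ := fun ω => β * S.bregman y x Q.xstar
    + inner ℝ (S.noise Q x ω) (Q.xstar - x) + dualNorm S.nrm (S.noise Q x ω) ^ 2 / β with hh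
  have hpt : ∀ ω, ENNReal.ofReal (Q.g (S.prox β (S.gradG Q x ω) x y) - Q.g Q.xstar)
        + ENNReal.ofReal (β * S.bregman y (S.prox β (S.gradG Q x ω) x y) Q.xstar) ≤
      ENNReal.ofReal (h ω) := fun ω => by
    rw [← ENNReal.ofReal_add (hQ.gap_nonneg (hS.prox_mem hβ _ _ _))
      (mul_nonneg hβ.le (hS.bregman_nonneg _ _ _))]
    exact ENNReal.ofReal_le_ofReal (hQ.prox_step_le hS hβ hβν hx y ω)
  have h0 : ∀ ω, 0 ≤ h ω := fun ω =>
    (add_nonneg (hQ.gap_nonneg (hS.prox_mem hβ _ _ _))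
      (mul_nonneg hβ.le (hS.bregman_nonneg _ _ _))).trans (hQ.prox_step_le hS hβ hβν hx y ω)
  have hi1 : Integrable (fun ω => inner ℝ (S.noise Q x ω) (Q.xstar - x)) Q.P :=
    (hQ.integrable_noise_vec hx).inner_const _
  have hi2 : Integrable (fun ω => dualNorm S.nrm (S.noise Q x ω) ^ 2 / β) Q.P :=
    (hQ.integrable_noise x hx).div_const _
  have hi0 : Integrable (fun ω => β * S.bregman y x Q.xstar
      + inner ℝ (S.noise Q x ω) (Q.xstar - x)) Q.P := (integrable_const _).add hi1
  have hint : Integrable h Q.P := hi0.add hi2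
  have hval : ∫ ω, h ω ∂Q.P = β * S.bregman y x Q.xstar
      + (∫ ω, dualNorm S.nrm (S.noise Q x ω) ^ 2 ∂Q.P) / β := by
    have e1 : ∫ ω, inner ℝ (S.noise Q x ω) (Q.xstar - x) ∂Q.P = 0 := by
      simp_rw [real_inner_comm (Q.xstar - x)]
      rw [integral_inner (hQ.integrable_noise_vec hx), hQ.integral_noise hx, inner_zero_right]
    simp only [hh]
    rw [integral_add hi0 hi2, integral_add (integrable_const _) hi1, e1, integral_div]
    simp
  calc _ ≤ ∫⁻ ω, ENNReal.ofReal (h ω) ∂Q.P := lintegral_mono hpt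
    _ = ENNReal.ofReal (∫ ω, h ω ∂Q.P) :=
      (ofReal_integral_eq_lintegral_ofReal hint (Filter.Eventually.of_forall h0)).symm
    _ ≤ ENNReal.ofReal (β * S.bregman y x Q.xstar + S.optBregman Q x / 2
          + S.ϰ' * S.ς ^ 2 / β) := by
      refine ENNReal.ofReal_le_ofReal ?_
      rw [hval]
      have hv := div_le_div_of_nonneg_right (hQ.variance x hx) hβ.le
      have hD := hQ.optBregman_nonneg hS hx
      have : S.ϰ * S.ν * S.optBregman Q x / β ≤ S.optBregman Q x / 2 := by
        rw [div_le_div_iff₀ hβ two_pos]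
        nlinarith
      rw [add_div] at hv
      simp only [Setting.optBregman] at this ⊢
      linarith
    _ ≤ _ := (ENNReal.ofReal_add_le).trans (add_le_add_left ENNReal.ofReal_add_le _)

end Setting.InClass

end Step

/-! ### One stage of mirror descent -/

/-- Drawing one coordinate afresh does not change the law. This replaces conditioning on the earlier
observations. The proof uses that integrating out a coordinate twice is the same as doing it once.
-/
lemma lintegral_pi_update {ι : Type*} [Fintype ι] [DecidableEq ι] {Ω : Type*} [MeasurableSpace Ω]
    (P : Measure Ω) [IsProbabilityMeasure P] (n : ι) {f : (ι → Ω) → ℝ≥0∞} (hf : Measurable f) :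
    ∫⁻ w, f w ∂Measure.pi (fun _ : ι => P) =
      ∫⁻ w, ∫⁻ ω, f (Function.update w n ω) ∂P ∂Measure.pi (fun _ : ι => P) := by
  have h := lmarginal_singleton (μ := fun _ : ι => P) f n
  have hm : Measurable (∫⋯∫⁻_{n}, f ∂fun _ : ι => P) := hf.lmarginal _
  have h2 : ∫⁻ w, f w ∂Measure.pi (fun _ : ι => P) =
      ∫⁻ w, (∫⋯∫⁻_{n}, f ∂fun _ : ι => P) w ∂Measure.pi (fun _ : ι => P) := by
    refine lintegral_eq_of_lmarginal_eq {n} hf hm ?_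
    rw [lmarginal_singleton (f := ∫⋯∫⁻_{n}, f ∂fun _ : ι => P)]
    funext w
    simp only [lmarginal_update_of_mem (fun _ : ι => P) (Finset.mem_singleton_self n),
      lintegral_const, measure_univ, mul_one]
  rw [h2, h]

/-! ### Random points that depend on the past observations only -/

section State

variable {E : Type v} [NormedAddCommGroup E] [InnerProductSpace ℝ E] [MeasurableSpace E]
  {S : Setting E} {Q : Problem.{u} E} {M : ℕ}

/-- A measurable `X`-valued function of the observations with number less than `n`. -/
structure Setting.IsState (S : Setting E) (Q : Problem.{u} E) {M : ℕ} (n : ℕ)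
    (x : (Fin M → Q.Ω) → E) : Prop where
  measurable : Measurable x
  mem : ∀ w, x w ∈ S.X
  dependsOn : DependsOn x {j : Fin M | (j : ℕ) < n}

lemma Setting.IsState.mono {n n' : ℕ} {x : (Fin M → Q.Ω) → E} (hx : S.IsState Q n x)
    (h : n ≤ n') : S.IsState Q n' x where
  measurable := hx.measurable
  mem := hx.mem
  dependsOn := fun _ _ hw => hx.dependsOn fun j hj => hw j (lt_of_lt_of_le hj h)

lemma Setting.IsState.update {n : ℕ} {x : (Fin M → Q.Ω) → E} (hx : S.IsState Q n x)
    (hn : n < M) (w : Fin M → Q.Ω) (ω : Q.Ω) : x (Function.update w ⟨n, hn⟩ ω) = x w :=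
  hx.dependsOn fun j hj => Function.update_of_ne (fun h => by simp [h] at hj) _ _

end State

section Stage

variable {E : Type v} [NormedAddCommGroup E] [InnerProductSpace ℝ E] [CompleteSpace E]
  [MeasurableSpace E] {S : Setting E} {Q : Problem.{u} E} {M : ℕ}

lemma Setting.InClass.measurable_gap {n : ℕ} [BorelSpace E] (hQ : S.InClass Q)
    {x : (Fin M → Q.Ω) → E} (hx : S.IsState Q n x) :
    Measurable fun w => Q.g (x w) - Q.g Q.xstar := by
  have h : Measurable (S.X.domRestrict Q.g) :=
    (continuousOn_iff_continuous_domRestrict.mp hQ.differentiable.continuousOn).measurable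
  exact (h.comp (hx.measurable.subtype_mk (h := hx.mem))).sub_const _

lemma Setting.IsState.sparse (hS : S.Standing) {n : ℕ} {x : (Fin M → Q.Ω) → E}
    (hx : S.IsState Q n x) : S.IsState Q n fun w => S.sparse (x w) where
  measurable := hS.sparse_measurable.comp (hx.measurable.subtype_mk (h := hx.mem))
  mem := fun w => hS.sparse_mem _ (hx.mem w)
  dependsOn := fun _ _ hw => congrArg S.sparse (hx.dependsOn hw)

/-- The mirror descent trajectory on a stage that starts at `y` with observation number `o`. -/
def Setting.stagePath (S : Setting E) (Q : Problem.{u} E) {M : ℕ} (β : ℝ) (o : ℕ)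
    (y : (Fin M → Q.Ω) → E) (i : ℕ) (w : Fin M → Q.Ω) : E :=
  S.path β (y w) (fun j => S.oracle Q w (o + j)) i

lemma Setting.stagePath_succ {E : Type v} [NormedAddCommGroup E] [InnerProductSpace ℝ E]
    [CompleteSpace E] {S : Setting E} {Q : Problem.{u} E} {M : ℕ}
    {β : ℝ} {o : ℕ} (y : (Fin M → Q.Ω) → E) {i : ℕ} (h : o + i < M)
    (w : Fin M → Q.Ω) :
    S.stagePath Q β o y (i + 1) w = S.prox β (S.gradG Q (S.stagePath Q β o y i w) (w ⟨o + i, h⟩))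
      (S.stagePath Q β o y i w) (y w) := by
  rw [Setting.stagePath, Setting.path, Setting.oracle, dif_pos h]
  rfl

/-- The result of a stage. -/
def Setting.stageOut (S : Setting E) (Q : Problem.{u} E) {M : ℕ} (β : ℝ) (m o : ℕ)
    (y : (Fin M → Q.Ω) → E) (w : Fin M → Q.Ω) : E :=
  S.smd β m (y w) (fun j => S.oracle Q w (o + j))

lemma Setting.InClass.measurable_gradG_comp {α : Type*} [MeasurableSpace α] (hQ : S.InClass Q)
    {x : α → E} {t : α → Q.Ω} (hx : Measurable x) (hxX : ∀ a, x a ∈ S.X) (ht : Measurable t) :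
    Measurable fun a => S.gradG Q (x a) (t a) :=
  hQ.measurable_gradG.comp (g := fun z : S.X × Q.Ω => S.gradG Q z.1 z.2)
    (f := fun a => ((⟨x a, hxX a⟩ : S.X), t a)) ((hx.subtype_mk (h := hxX)).prodMk ht)

variable [FiniteDimensional ℝ E]

lemma Setting.smd_mem (hS : S.Standing) {β : ℝ} (hβ : 0 < β) {m : ℕ} (hm : 0 < m) (y : E)
    (H : ℕ → E → E) : S.smd β m y H ∈ S.X := by
  have hm' : (0 : ℝ) < m := by exact_mod_cast hm
  rw [Setting.smd, Finset.smul_sum]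
  refine hS.convex.sum_mem (fun _ _ => by positivity) (by simp [hm'.ne']) fun i _ => ?_
  exact hS.prox_mem hβ _ _ _

variable [BorelSpace E]

lemma Setting.Standing.measurable_prox_comp {α : Type*} [MeasurableSpace α] (hS : S.Standing)
    {β : ℝ} (hβ : 0 < β) {q x y : α → E} (hq : Measurable q) (hx : Measurable x)
    (hy : Measurable y) : Measurable fun a => S.prox β (q a) (x a) (y a) :=
  (hS.continuous_prox hβ).measurable.comp (hq.prodMk (hx.prodMk hy))

lemma Setting.Standing.measurable_bregman_comp {α : Type*} [MeasurableSpace α] (hS : S.Standing)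
    {q x y : α → E} (hq : Measurable q) (hx : Measurable x)
    (hy : Measurable y) : Measurable fun a => S.bregman (q a) (x a) (y a) :=
  hS.continuous_bregman.measurable.comp (hq.prodMk (hx.prodMk hy))

lemma Setting.IsState.stagePath (hS : S.Standing) (hQ : S.InClass Q) {β : ℝ} (hβ : 0 < β) {o : ℕ}
    {y : (Fin M → Q.Ω) → E} (hy : S.IsState Q o y) {i : ℕ} (hi : o + i ≤ M) :
    S.IsState Q (o + i) (S.stagePath Q β o y i) := by
  induction i with
  | zero => exact hy
  | succ i ih =>
    have hlt : o + i < M := by omega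
    have hx := ih hlt.le
    have e : S.stagePath Q β o y (i + 1) = fun w =>
        S.prox β (S.gradG Q (S.stagePath Q β o y i w) (w ⟨o + i, hlt⟩))
          (S.stagePath Q β o y i w) (y w) := funext fun w => Setting.stagePath_succ y hlt w
    rw [e]
    refine ⟨?_, fun w => hS.prox_mem hβ _ _ _, fun w w' hw => ?_⟩
    · have hG : Measurable fun w : Fin M → Q.Ω =>
          S.gradG Q (S.stagePath Q β o y i w) (w ⟨o + i, hlt⟩) :=
        hQ.measurable_gradG_comp hx.measurable hx.mem (measurable_pi_apply _)
      exact hS.measurable_prox_comp hβ hG hx.measurable hy.measurable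
    · have h1 : S.stagePath Q β o y i w = S.stagePath Q β o y i w' :=
        hx.dependsOn fun j (hj : (j : ℕ) < o + i) => hw j (show (j : ℕ) < o + (i + 1) by omega)
      have h2 : y w = y w' :=
        hy.dependsOn fun j (hj : (j : ℕ) < o) => hw j (show (j : ℕ) < o + (i + 1) by omega)
      have h3 : w ⟨o + i, hlt⟩ = w' ⟨o + i, hlt⟩ := hw _ (show o + i < o + (i + 1) by omega)
      simp only [h1, h2, h3]

lemma Setting.IsState.stageOut (hS : S.Standing) (hQ : S.InClass Q) {β : ℝ} (hβ : 0 < β)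
    {m o : ℕ} (hm : 0 < m) {y : (Fin M → Q.Ω) → E} (hy : S.IsState Q o y) (hmM : o + m ≤ M) :
    S.IsState Q (o + m) (S.stageOut Q β m o y) := by
  have hst : ∀ i ∈ Finset.range m, S.IsState Q (o + m) (S.stagePath Q β o y (i + 1)) :=
    fun i hi => (hy.stagePath hS hQ hβ (by have := Finset.mem_range.mp hi; omega)).mono (by
      have := Finset.mem_range.mp hi; omega)
  refine ⟨?_, fun w => S.smd_mem hS hβ hm _ _, fun w w' hw => ?_⟩
  · exact (Finset.measurable_fun_sum _ fun i hi => (hst i hi).measurable).const_smul (m : ℝ)⁻¹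
  · exact congrArg ((m : ℝ)⁻¹ • ·) (Finset.sum_congr rfl fun i hi => (hst i hi).dependsOn hw)

/-- The law of `M` independent observations. -/
abbrev Problem.obsLaw (Q : Problem.{u} E) (M : ℕ) : Measure (Fin M → Q.Ω) :=
  Measure.pi fun _ => Q.P

/-- Observation o + i is drawn afresh. Neither y nor iterate i depends on it, so the one-step bound
applies for each fixed value of the others. -/
lemma Setting.InClass.lintegral_path_step_le (hS : S.Standing) (hQ : S.InClass Q) {β : ℝ}
    (hβ : 0 < β) (hβν : 2 * S.ϰ * S.ν ≤ β) {o : ℕ} {y : (Fin M → Q.Ω) → E}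
    (hy : S.IsState Q o y) {i : ℕ} (hi : o + i < M) :
    ∫⁻ w, ENNReal.ofReal (Q.g (S.stagePath Q β o y (i + 1) w) - Q.g Q.xstar) ∂Q.obsLaw M
      + ∫⁻ w, ENNReal.ofReal
          (β * S.bregman (y w) (S.stagePath Q β o y (i + 1) w) Q.xstar) ∂Q.obsLaw M ≤
    ∫⁻ w, ENNReal.ofReal (β * S.bregman (y w) (S.stagePath Q β o y i w) Q.xstar) ∂Q.obsLaw M
      + ∫⁻ w, ENNReal.ofReal (S.optBregman Q (S.stagePath Q β o y i w) / 2) ∂Q.obsLaw M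
      + ENNReal.ofReal (S.ϰ' * S.ς ^ 2 / β) := by
  have hx := hy.stagePath hS hQ hβ hi.le
  have hx' := hy.stagePath hS hQ hβ (i := i + 1) hi
  have hV : ∀ j, o + j ≤ M → Measurable fun w =>
      ENNReal.ofReal (β * S.bregman (y w) (S.stagePath Q β o y j w) Q.xstar) := fun j hj =>
    ((hS.measurable_bregman_comp hy.measurable (hy.stagePath hS hQ hβ hj).measurable
      measurable_const).const_mul β).ennreal_ofReal
  have hG := (hQ.measurable_gap hx').ennreal_ofReal
  have hGV : Measurable fun w =>
      ENNReal.ofReal (Q.g (S.stagePath Q β o y (i + 1) w) - Q.g Q.xstar)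
        + ENNReal.ofReal (β * S.bregman (y w) (S.stagePath Q β o y (i + 1) w) Q.xstar) :=
    hG.add (hV (i + 1) hi)
  rw [← lintegral_add_left hG, lintegral_pi_update Q.P ⟨o + i, hi⟩ hGV,
    ← lintegral_add_left (hV i hi.le)]
  calc _ ≤ ∫⁻ w, (ENNReal.ofReal (β * S.bregman (y w) (S.stagePath Q β o y i w) Q.xstar)
          + ENNReal.ofReal (S.optBregman Q (S.stagePath Q β o y i w) / 2)
          + ENNReal.ofReal (S.ϰ' * S.ς ^ 2 / β)) ∂Q.obsLaw M := by
        refine lintegral_mono fun w => ?_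
        have hyu := fun ω => (hy.mono (Nat.le_add_right o i)).update hi w ω
        simp only [Setting.stagePath_succ y hi, hx.update hi w, hyu, Function.update_self]
        exact hQ.lintegral_prox_step_le hS hβ hβν (hx.mem w) (y w)
    _ = _ := by
        rw [lintegral_add_right _ measurable_const]
        simp

/-- The last gap is kept in full, so that half of it can pay for the `optBregman` term of the next
step. All earlier gaps retain their other half. Additions only are used, as extended nonnegative
integrals cannot be subtracted freely. -/
lemma Setting.InClass.sum_lintegral_gap_le (hS : S.Standing) (hQ : S.InClass Q) {β : ℝ}
    (hβ : 0 < β) (hβν : 2 * S.ϰ * S.ν ≤ β) {o : ℕ} {y : (Fin M → Q.Ω) → E}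
    (hy : S.IsState Q o y) {m : ℕ} (hm : o + (m + 1) ≤ M) :
    ∑ i ∈ Finset.range m,
        ∫⁻ w, ENNReal.ofReal ((Q.g (S.stagePath Q β o y (i + 1) w) - Q.g Q.xstar) / 2) ∂Q.obsLaw M
      + (∫⁻ w, ENNReal.ofReal (Q.g (S.stagePath Q β o y (m + 1) w) - Q.g Q.xstar) ∂Q.obsLaw M
      + ∫⁻ w, ENNReal.ofReal
          (β * S.bregman (y w) (S.stagePath Q β o y (m + 1) w) Q.xstar) ∂Q.obsLaw M) ≤
    ∫⁻ w, ENNReal.ofReal (β * S.bregman (y w) (y w) Q.xstar) ∂Q.obsLaw M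
      + ∫⁻ w, ENNReal.ofReal (S.optBregman Q (y w) / 2) ∂Q.obsLaw M
      + (m + 1) * ENNReal.ofReal (S.ϰ' * S.ς ^ 2 / β) := by
  induction m with
  | zero =>
    have h := hQ.lintegral_path_step_le hS hβ hβν hy (i := 0) (by omega)
    simpa [Setting.stagePath, Setting.path] using h
  | succ m ih =>
    have h1 := ih (by omega)
    have h2 := hQ.lintegral_path_step_le hS hβ hβν hy (i := m + 1) (by omega)
    have hx := hy.stagePath hS hQ hβ (i := m + 1) (by omega)
    have hG : Measurable fun w =>
        ENNReal.ofReal ((Q.g (S.stagePath Q β o y (m + 1) w) - Q.g Q.xstar) / 2) :=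
      ((hQ.measurable_gap hx).div_const 2).ennreal_ofReal
    have h3 : ∫⁻ w, ENNReal.ofReal (S.optBregman Q (S.stagePath Q β o y (m + 1) w) / 2)
        ∂Q.obsLaw M ≤ ∫⁻ w, ENNReal.ofReal
          ((Q.g (S.stagePath Q β o y (m + 1) w) - Q.g Q.xstar) / 2) ∂Q.obsLaw M :=
      lintegral_mono fun w => ENNReal.ofReal_le_ofReal (by
        have := hQ.optBregman_le_gap hS (hx.mem w); linarith)
    have h4 : ∫⁻ w, ENNReal.ofReal (Q.g (S.stagePath Q β o y (m + 1) w) - Q.g Q.xstar)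
          ∂Q.obsLaw M =
        ∫⁻ w, ENNReal.ofReal ((Q.g (S.stagePath Q β o y (m + 1) w) - Q.g Q.xstar) / 2)
          ∂Q.obsLaw M + ∫⁻ w, ENNReal.ofReal
          ((Q.g (S.stagePath Q β o y (m + 1) w) - Q.g Q.xstar) / 2) ∂Q.obsLaw M := by
      rw [← lintegral_add_left hG]
      refine lintegral_congr fun w => ?_
      have := hQ.gap_nonneg (hx.mem w)
      rw [← ENNReal.ofReal_add (by linarith) (by linarith), add_halves]
    rw [h4] at h1
    rw [Finset.sum_range_succ]
    push_cast
    set A := ∑ i ∈ Finset.range m, ∫⁻ w, ENNReal.ofReal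
      ((Q.g (S.stagePath Q β o y (i + 1) w) - Q.g Q.xstar) / 2) ∂Q.obsLaw M
    set B := ∫⁻ w, ENNReal.ofReal ((Q.g (S.stagePath Q β o y (m + 1) w) - Q.g Q.xstar) / 2)
      ∂Q.obsLaw M
    set V := ∫⁻ w, ENNReal.ofReal
      (β * S.bregman (y w) (S.stagePath Q β o y (m + 1) w) Q.xstar) ∂Q.obsLaw M
    set c := ENNReal.ofReal (S.ϰ' * S.ς ^ 2 / β)
    set I := ∫⁻ w, ENNReal.ofReal (β * S.bregman (y w) (y w) Q.xstar) ∂Q.obsLaw M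
      + ∫⁻ w, ENNReal.ofReal (S.optBregman Q (y w) / 2) ∂Q.obsLaw M
    calc _ ≤ A + B + (V + B + c) := by
          refine add_le_add_right (h2.trans ?_) _
          gcongr
      _ = A + (B + B + V) + c := by ring
      _ ≤ I + (m + 1) * c + c := by gcongr
      _ = _ := by ring

/-- At the start of the stage βV ≤ βΘ‖y − x_*‖² and `optBregman`/2 ≤ ν/4·‖y − x_*‖². In the factor
4/(κm), 2/κ comes from quadratic growth, 1/m from Jensen's inequality for the average, and 2 from
summing half gaps. -/
lemma Setting.InClass.lintegral_stageOut_le (hS : S.Standing) (hQ : S.InClass Q) {β : ℝ}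
    (hβ : 0 < β) (hβν : 2 * S.ϰ * S.ν ≤ β) {o : ℕ} {y : (Fin M → Q.Ω) → E}
    (hy : S.IsState Q o y) {m : ℕ} (hm : 0 < m) (hmM : o + m ≤ M) {ρ : ℝ} (hρ : 0 ≤ ρ)
    (hyρ : ∫⁻ w, ENNReal.ofReal (S.nrm (y w - Q.xstar) ^ 2) ∂Q.obsLaw M ≤ ENNReal.ofReal ρ) :
    ∫⁻ w, ENNReal.ofReal (‖S.stageOut Q β m o y w - Q.xstar‖ ^ 2) ∂Q.obsLaw M ≤
      ENNReal.ofReal (4 / (S.κ * m) * (β * S.Θ + S.ν / 4) * ρ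
        + 4 * S.ϰ' * S.ς ^ 2 / (S.κ * β)) := by
  obtain ⟨k, rfl⟩ : ∃ k, m = k + 1 := ⟨m - 1, by omega⟩
  have hκ := hS.κ_pos
  have hΘ : 0 < S.Θ := by linarith [hS.half_le_Θ]
  have hν : 0 ≤ S.ν := hS.lip_nonneg.trans hS.lip_le
  have hϰ' : 0 ≤ S.ϰ' := by linarith [hS.one_le_ϰ']
  have hst : ∀ i ∈ Finset.range (k + 1), S.IsState Q (o + (i + 1)) (S.stagePath Q β o y (i + 1)) :=
    fun i hi => hy.stagePath hS hQ hβ (by have := Finset.mem_range.mp hi; omega)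
  set c := ENNReal.ofReal (S.ϰ' * S.ς ^ 2 / β)
  set a : ℕ → ℝ≥0∞ := fun i =>
    ∫⁻ w, ENNReal.ofReal ((Q.g (S.stagePath Q β o y (i + 1) w) - Q.g Q.xstar) / 2) ∂Q.obsLaw M
  have hsum : ∑ i ∈ Finset.range (k + 1), a i ≤
      ENNReal.ofReal ((β * S.Θ + S.ν / 4) * ρ) + (k + 1) * c := by
    have h := hQ.sum_lintegral_gap_le hS hβ hβν hy hmM
    have h1 : a k ≤ ∫⁻ w, ENNReal.ofReal
        (Q.g (S.stagePath Q β o y (k + 1) w) - Q.g Q.xstar) ∂Q.obsLaw M :=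
      lintegral_mono fun w => ENNReal.ofReal_le_ofReal
        (half_le_self (hQ.gap_nonneg ((hst k (by simp)).mem w)))
    rw [Finset.sum_range_succ]
    refine (add_le_add_right (h1.trans le_self_add) _).trans (h.trans ?_)
    gcongr
    rw [← lintegral_add_left ((hS.measurable_bregman_comp hy.measurable hy.measurable
      measurable_const).const_mul β).ennreal_ofReal]
    calc _ ≤ ∫⁻ w, ENNReal.ofReal (β * S.Θ + S.ν / 4) *
            ENNReal.ofReal (S.nrm (y w - Q.xstar) ^ 2) ∂Q.obsLaw M := by
          refine lintegral_mono fun w => ?_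
          have h2 := hS.bregman_start_le (y w) Q.xstar
          have h3 := hQ.optBregman_le_nrm hS (hy.mem w)
          have h4 := mul_le_mul_of_nonneg_left h2 hβ.le
          rw [map_sub_rev] at h4
          rw [← ENNReal.ofReal_mul (by positivity), ← ENNReal.ofReal_add
            (mul_nonneg hβ.le (hS.bregman_nonneg _ _ _))
            (by have := hQ.optBregman_nonneg hS (hy.mem w); linarith)]
          exact ENNReal.ofReal_le_ofReal (by linarith)
      _ ≤ ENNReal.ofReal (β * S.Θ + S.ν / 4) * ENNReal.ofReal ρ := by
          rw [lintegral_const_mul' _ _ ENNReal.ofReal_ne_top]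
          gcongr
      _ = _ := (ENNReal.ofReal_mul (by positivity)).symm
  have hk : (0 : ℝ) < (k + 1 : ℕ) := by positivity
  have hpt : ∀ w, ENNReal.ofReal (‖S.stageOut Q β (k + 1) o y w - Q.xstar‖ ^ 2) ≤
      ENNReal.ofReal (4 / (S.κ * (k + 1 : ℕ))) * ∑ i ∈ Finset.range (k + 1),
        ENNReal.ofReal ((Q.g (S.stagePath Q β o y (i + 1) w) - Q.g Q.xstar) / 2) := fun w => by
    have h1 := hQ.growth _ (S.smd_mem hS hβ hm (y w) (fun j => S.oracle Q w (o + j)))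
    have h2 : Q.g (S.stageOut Q β (k + 1) o y w) ≤ ∑ i ∈ Finset.range (k + 1),
        ((k + 1 : ℕ) : ℝ)⁻¹ • Q.g (S.stagePath Q β o y (i + 1) w) := by
      rw [Setting.stageOut, Setting.smd, Finset.smul_sum]
      exact hQ.convex.map_sum_le (fun _ _ => by positivity) (by simp; field_simp)
        fun i hi => (hst i hi).mem w
    have h3 : ∑ i ∈ Finset.range (k + 1), (Q.g (S.stagePath Q β o y (i + 1) w) - Q.g Q.xstar) / 2 =
        ((k + 1 : ℕ) / 2) * (∑ i ∈ Finset.range (k + 1),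
        ((k + 1 : ℕ) : ℝ)⁻¹ • Q.g (S.stagePath Q β o y (i + 1) w) - Q.g Q.xstar) := by
      rw [← Finset.smul_sum, ← Finset.sum_div, Finset.sum_sub_distrib, smul_eq_mul]
      simp
      field_simp
    rw [← ENNReal.ofReal_sum_of_nonneg fun i hi => by
      have := hQ.gap_nonneg ((hst i hi).mem w); linarith, ← ENNReal.ofReal_mul (by positivity)]
    refine ENNReal.ofReal_le_ofReal ?_
    rw [h3]
    have e : 4 / (S.κ * (k + 1 : ℕ)) * (((k + 1 : ℕ) / 2) * (∑ i ∈ Finset.range (k + 1),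
        ((k + 1 : ℕ) : ℝ)⁻¹ • Q.g (S.stagePath Q β o y (i + 1) w) - Q.g Q.xstar)) =
        (∑ i ∈ Finset.range (k + 1),
        ((k + 1 : ℕ) : ℝ)⁻¹ • Q.g (S.stagePath Q β o y (i + 1) w) - Q.g Q.xstar) / (S.κ / 2) := by
      field_simp
      ring
    rw [e, le_div_iff₀ (by positivity)]
    rw [Setting.stageOut] at h2 ⊢
    linarith
  calc _ ≤ ∫⁻ w, ENNReal.ofReal (4 / (S.κ * (k + 1 : ℕ))) * ∑ i ∈ Finset.range (k + 1),
        ENNReal.ofReal ((Q.g (S.stagePath Q β o y (i + 1) w) - Q.g Q.xstar) / 2) ∂Q.obsLaw M :=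
        lintegral_mono hpt
    _ = ENNReal.ofReal (4 / (S.κ * (k + 1 : ℕ))) * ∑ i ∈ Finset.range (k + 1), a i := by
        rw [lintegral_const_mul' _ _ ENNReal.ofReal_ne_top, lintegral_finsetSum]
        exact fun i hi => ((hQ.measurable_gap (hst i hi)).div_const 2).ennreal_ofReal
    _ ≤ ENNReal.ofReal (4 / (S.κ * (k + 1 : ℕ))) *
          (ENNReal.ofReal ((β * S.Θ + S.ν / 4) * ρ) + (k + 1) * c) := by gcongr
    _ = _ := by
        have e : ((k : ℝ≥0∞) + 1) * c = ENNReal.ofReal ((k + 1 : ℕ) * (S.ϰ' * S.ς ^ 2 / β)) := by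
          rw [ENNReal.ofReal_mul hk.le, ENNReal.ofReal_natCast]
          push_cast
          rfl
        rw [e, ← ENNReal.ofReal_add (by positivity) (by positivity),
          ← ENNReal.ofReal_mul (by positivity)]
        congr 1
        field_simp

end Stage

/-! ### The multistage algorithm -/

section Multistage

variable {E : Type v} [NormedAddCommGroup E] [InnerProductSpace ℝ E] [CompleteSpace E]
  [MeasurableSpace E] {S : Setting E} {Q : Problem.{u} E} {M : ℕ}

/-- The complexity `s̄Θϰν/κ` of a stage. -/
def Setting.stageCost (S : Setting E) : ℝ := S.sbar * S.Θ * S.ν * S.ϰ / S.κ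

/-- The squared accuracy that is attained by the preliminary phase. -/
def Setting.noiseFloor (S : Setting E) : ℝ :=
  32 * S.ς ^ 2 * S.sbar * S.ϰ' / (S.κ * S.ν * S.ϰ)

namespace Setting.Standing

lemma ϰ_pos (hS : S.Standing) : 0 < S.ϰ := by linarith [hS.one_le_ϰ]

lemma ϰ'_pos (hS : S.Standing) : 0 < S.ϰ' := by linarith [hS.one_le_ϰ']

lemma Θ_pos (hS : S.Standing) : 0 < S.Θ := by linarith [hS.half_le_Θ]

/-- The condition m₀ > 1 acts through this bound: it forces s̄ and ν to be positive and makes the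
error of rounding up comparable to `stageCost`. -/
lemma one_lt_m₀_arg {E : Type v} [NormedAddCommGroup E] [InnerProductSpace ℝ E]
    {S : Setting E} (hm : 1 < S.m₀) :
    1 < 16 * S.κ⁻¹ * S.sbar * (8 * S.Θ * S.ϰ + 1) * S.ν := by
  have h := Nat.lt_ceil.mp hm
  simpa using h

lemma sbar_nonneg (hS : S.Standing) : 0 ≤ S.sbar := hS.s_nonneg.trans hS.s_le

lemma sbar_pos (hS : S.Standing) (hm : 1 < S.m₀) : 0 < S.sbar := by
  refine lt_of_le_of_ne hS.sbar_nonneg fun h => ?_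
  have := one_lt_m₀_arg hm
  rw [← h] at this
  norm_num at this

lemma ν_pos (hS : S.Standing) (hm : 1 < S.m₀) : 0 < S.ν := by
  refine lt_of_le_of_ne (hS.lip_nonneg.trans hS.lip_le) fun h => ?_
  have := one_lt_m₀_arg hm
  rw [← h] at this
  norm_num at this

lemma stageCost_pos (hS : S.Standing) (hm : 1 < S.m₀) : 0 < S.stageCost := by
  have := hS.sbar_pos hm
  have := hS.ν_pos hm
  have := hS.κ_pos
  have := hS.ϰ_pos
  have := hS.Θ_pos
  rw [Setting.stageCost]
  positivity

lemma noiseFloor_nonneg (hS : S.Standing) (hm : 1 < S.m₀) : 0 ≤ S.noiseFloor := by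
  have := hS.sbar_pos hm
  have := hS.ν_pos hm
  have := hS.κ_pos
  have := hS.ϰ_pos
  have := hS.ϰ'_pos
  rw [Setting.noiseFloor]
  positivity

lemma noiseFloor_pos (hS : S.Standing) (hm : 1 < S.m₀) (hς : S.ς ≠ 0) : 0 < S.noiseFloor := by
  have := hS.sbar_pos hm
  have := hS.ν_pos hm
  have := hS.κ_pos
  have := hS.ϰ_pos
  have := hS.ϰ'_pos
  have := lt_of_le_of_ne hS.ς_nonneg hς.symm
  rw [Setting.noiseFloor]
  positivity

lemma half_le_Θϰ (hS : S.Standing) : 1 / 2 ≤ S.Θ * S.ϰ := by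
  nlinarith [hS.half_le_Θ, hS.one_le_ϰ]

lemma m₀_le (hS : S.Standing) (hm : 1 < S.m₀) : (S.m₀ : ℝ) ≤ 320 * S.stageCost := by
  have h1 := one_lt_m₀_arg hm
  have h2 : (S.m₀ : ℝ) < 16 * S.κ⁻¹ * S.sbar * (8 * S.Θ * S.ϰ + 1) * S.ν + 1 :=
    Nat.ceil_lt_add_one (by linarith)
  have h3 : 16 * S.κ⁻¹ * S.sbar * (8 * S.Θ * S.ϰ + 1) * S.ν ≤ 160 * S.stageCost := by
    have h4 : 8 * S.Θ * S.ϰ + 1 ≤ 10 * (S.Θ * S.ϰ) := by linarith [hS.half_le_Θϰ]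
    have := hS.sbar_pos hm
    have := hS.ν_pos hm
    have := hS.κ_pos
    calc _ ≤ 16 * S.κ⁻¹ * S.sbar * (10 * (S.Θ * S.ϰ)) * S.ν := by gcongr
      _ = _ := by rw [Setting.stageCost]; field_simp; ring
  linarith

lemma one_le_stageCost (hS : S.Standing) (hm : 1 < S.m₀) : 1 ≤ 160 * S.stageCost := by
  have h1 : (2 : ℝ) ≤ S.m₀ := by exact_mod_cast hm
  linarith [hS.m₀_le hm]

lemma le_m {E : Type v} [NormedAddCommGroup E] [InnerProductSpace ℝ E] (S : Setting E)
    (k : ℕ) : 512 * S.stageCost * 2 ^ k ≤ S.m k := Nat.le_ceil _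

lemma m_pos (hS : S.Standing) (hm : 1 < S.m₀) (k : ℕ) : 0 < S.m k := by
  have h := hS.stageCost_pos hm
  exact Nat.ceil_pos.mpr (by rw [Setting.stageCost] at h; positivity)

lemma m_le (hS : S.Standing) (hm : 1 < S.m₀) (k : ℕ) : (S.m k : ℝ) ≤ 672 * S.stageCost * 2 ^ k := by
  have h := hS.stageCost_pos hm
  have h1 := hS.one_le_stageCost hm
  have h2 : (S.m k : ℝ) < 512 * S.stageCost * 2 ^ k + 1 :=
    Nat.ceil_lt_add_one (by positivity)
  have h3 : (1 : ℝ) ≤ 2 ^ k := one_le_pow₀ one_le_two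
  nlinarith

lemma sum_m_le (hS : S.Standing) (hm : 1 < S.m₀) (k : ℕ) :
    ((∑ j ∈ Finset.Icc 1 k, S.m j : ℕ) : ℝ) ≤ 1344 * S.stageCost * 2 ^ k := by
  have h := hS.stageCost_pos hm
  induction k with
  | zero => simp; positivity
  | succ k ih =>
    rw [Finset.sum_Icc_succ_top (by omega)]
    push_cast at ih ⊢
    have := hS.m_le hm (k + 1)
    rw [pow_succ] at this ⊢
    linarith

/-- The number m₀ is chosen for this: the left side equals the argument of the ceiling divided by
2m₀. The factor 32s̄ is 4 from the stage bound times 8s̄ from sparsification. -/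
lemma prelim_contraction (hS : S.Standing) (hm : 1 < S.m₀) :
    32 * S.sbar / (S.κ * S.m₀) * (2 * S.ϰ * S.ν * S.Θ + S.ν / 4) ≤ 1 / 2 := by
  have h1 : 16 * S.κ⁻¹ * S.sbar * (8 * S.Θ * S.ϰ + 1) * S.ν ≤ S.m₀ := Nat.le_ceil _
  have hκ := hS.κ_pos
  have hm0 : (0 : ℝ) < S.m₀ := by exact_mod_cast (zero_lt_one.trans hm)
  have e : 32 * S.sbar / (S.κ * S.m₀) * (2 * S.ϰ * S.ν * S.Θ + S.ν / 4) =
      (16 * S.κ⁻¹ * S.sbar * (8 * S.Θ * S.ϰ + 1) * S.ν) / 2 / S.m₀ := by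
    field_simp
    ring
  rw [e, div_le_iff₀ hm0]
  linarith

lemma asymp_contraction (hS : S.Standing) (hm : 1 < S.m₀) (k : ℕ) :
    32 * S.sbar / (S.κ * S.m k) * (2 ^ k * S.ν * S.ϰ * S.Θ + S.ν / 4) ≤ 1 / 4 := by
  have h1 := le_m S k
  have hκ := hS.κ_pos
  have hm0 : (0 : ℝ) < S.m k := by exact_mod_cast hS.m_pos hm k
  have hν := hS.ν_pos hm
  have hs := hS.sbar_pos hm
  have h2 : S.ν / 4 ≤ 2 ^ k * S.ν * S.ϰ * S.Θ := by
    have h3 : (1 : ℝ) ≤ 2 ^ k := one_le_pow₀ one_le_two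
    have h4 := hS.half_le_Θϰ
    have h5 : 1 / 4 ≤ 2 ^ k * (S.Θ * S.ϰ) := by nlinarith
    nlinarith
  calc _ ≤ 32 * S.sbar / (S.κ * S.m k) *
        (2 ^ k * S.ν * S.ϰ * S.Θ + 2 ^ k * S.ν * S.ϰ * S.Θ) := by gcongr
    _ = (512 * S.stageCost * 2 ^ k) / 8 / S.m k := by
      rw [Setting.stageCost]; field_simp; ring
    _ ≤ 1 / 4 := by
      rw [div_le_iff₀ hm0]
      have : 0 ≤ 512 * S.stageCost * 2 ^ k := by
        have := hS.stageCost_pos hm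
        positivity
      linarith

end Setting.Standing

/-- Since x_* competes in the definition of `sparse`, the Euclidean error at most doubles. The error
is 2s-sparse, so passing to the other norm costs √(2s); the square of 2√(2s) is 8s. -/
lemma Setting.Standing.nrm_sparse_sub_sq_le (hS : S.Standing) (hQ : S.InClass Q) {x : E}
    (hx : x ∈ S.X) : S.nrm (S.sparse x - Q.xstar) ^ 2 ≤ 8 * S.sbar * ‖x - Q.xstar‖ ^ 2 := by
  have h1 := hS.nrm_le (2 * S.s) (by linarith [hS.s_nonneg]) _
    (hS.sparse_sub _ _ (hS.sparse_sparse x hx) hQ.xstar_sparse)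
  have h2 := hS.sparse_min x hx _ hQ.xstar_mem hQ.xstar_sparse
  have h3 : ‖S.sparse x - Q.xstar‖ ≤ 2 * ‖x - Q.xstar‖ := by
    have := norm_sub_le_norm_sub_add_norm_sub (S.sparse x) x Q.xstar
    rw [norm_sub_rev (S.sparse x) x] at this
    linarith
  have hs := hS.s_nonneg
  calc _ ≤ (√(2 * S.s) * (2 * ‖x - Q.xstar‖)) ^ 2 :=
        pow_le_pow_left₀ (apply_nonneg _ _) (h1.trans (by gcongr)) 2
    _ = 8 * S.s * ‖x - Q.xstar‖ ^ 2 := by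
        rw [mul_pow, Real.sq_sqrt (by linarith)]; ring
    _ ≤ _ := by gcongr; exact hS.s_le

lemma Setting.InClass.prelim_start (hS : S.Standing) (hQ : S.InClass Q) :
    S.IsState Q (M := M) 0 (fun w => (S.prelim (S.oracle Q w) 0).2) ∧
    ∫⁻ w, ENNReal.ofReal (S.nrm ((S.prelim (S.oracle Q w) 0).2 - Q.xstar) ^ 2) ∂Q.obsLaw M
      ≤ ENNReal.ofReal (S.R ^ 2) := by
  refine ⟨⟨measurable_const, fun _ => hS.start_mem, fun _ _ _ => rfl⟩, ?_⟩
  simp only [Setting.prelim, lintegral_const, measure_univ, mul_one]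
  refine ENNReal.ofReal_le_ofReal (pow_le_pow_left₀ (apply_nonneg _ _) ?_ 2)
  rw [map_sub_rev]
  exact hQ.xstar_near

variable [FiniteDimensional ℝ E] [BorelSpace E]

/-- The pair `z` of a point and its sparsification depends on the first `n` observations only, and
its mean square error is controlled by `ρ`. -/
structure Setting.HasError (S : Setting E) (Q : Problem.{u} E) {M : ℕ} (n : ℕ) (ρ : ℝ)
    (z : (Fin M → Q.Ω) → E × E) : Prop where
  state_fst : S.IsState Q n fun w => (z w).1
  state_snd : S.IsState Q n fun w => (z w).2
  lintegral_fst : ∫⁻ w, ENNReal.ofReal (8 * S.sbar * ‖(z w).1 - Q.xstar‖ ^ 2) ∂Q.obsLaw M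
    ≤ ENNReal.ofReal ρ
  lintegral_snd : ∫⁻ w, ENNReal.ofReal (S.nrm ((z w).2 - Q.xstar) ^ 2) ∂Q.obsLaw M
    ≤ ENNReal.ofReal ρ

lemma Setting.InClass.hasError_stage (hS : S.Standing) (hQ : S.InClass Q) {β : ℝ}
    (hβ : 0 < β) (hβν : 2 * S.ϰ * S.ν ≤ β) {o : ℕ} {y : (Fin M → Q.Ω) → E}
    (hy : S.IsState Q o y) {m : ℕ} (hm : 0 < m) (hmM : o + m ≤ M) {ρ ρ' : ℝ} (hρ : 0 ≤ ρ)
    (hyρ : ∫⁻ w, ENNReal.ofReal (S.nrm (y w - Q.xstar) ^ 2) ∂Q.obsLaw M ≤ ENNReal.ofReal ρ)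
    (hρ' : 32 * S.sbar / (S.κ * m) * (β * S.Θ + S.ν / 4) * ρ
      + 32 * S.sbar * S.ϰ' * S.ς ^ 2 / (S.κ * β) ≤ ρ') :
    S.HasError Q (o + m) ρ'
      fun w => (S.stageOut Q β m o y w, S.sparse (S.stageOut Q β m o y w)) := by
  have hst := hy.stageOut hS hQ hβ hm hmM
  have hs := hS.sbar_nonneg
  have h : ∫⁻ w, ENNReal.ofReal (8 * S.sbar * ‖S.stageOut Q β m o y w - Q.xstar‖ ^ 2)
      ∂Q.obsLaw M ≤ ENNReal.ofReal ρ' := by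
    simp_rw [ENNReal.ofReal_mul (show 0 ≤ 8 * S.sbar by positivity)]
    rw [lintegral_const_mul' _ _ ENNReal.ofReal_ne_top]
    refine (mul_le_mul_right (hQ.lintegral_stageOut_le hS hβ hβν hy hm hmM hρ hyρ) _).trans ?_
    rw [← ENNReal.ofReal_mul (by positivity)]
    refine ENNReal.ofReal_le_ofReal (le_trans (le_of_eq ?_) hρ')
    ring
  exact ⟨hst, hst.sparse hS, h, (lintegral_mono fun w => ENNReal.ofReal_le_ofReal
    (hS.nrm_sparse_sub_sq_le hQ (hst.mem w))).trans h⟩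

lemma Setting.InClass.hasError_prelim (hS : S.Standing) (hQ : S.InClass Q) (hm : 1 < S.m₀)
    {k : ℕ} (hk : (k + 1) * S.m₀ ≤ M) :
    S.HasError Q (M := M) ((k + 1) * S.m₀) ((1 / 2) ^ (k + 1) * S.R ^ 2 + S.noiseFloor)
      fun w => S.prelim (S.oracle Q w) (k + 1) := by
  have hν := hS.ν_pos hm
  have hϰ := hS.ϰ_pos
  have hκ := hS.κ_pos
  have hA := hS.noiseFloor_nonneg hm
  have hβ : 0 < 2 * S.ϰ * S.ν := by positivity
  -- The hypotheses concern the sparsified point only, because R bounds the distance of x₀ from x_*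
  -- in the other norm and `HasError` would also require the Euclidean bound. The value A is the
  -- fixed point of ρ ↦ ρ/2 + A/2.
  have key : ∀ k : ℕ, (k + 1) * S.m₀ ≤ M →
      S.IsState Q (M := M) (k * S.m₀) (fun w => (S.prelim (S.oracle Q w) k).2) →
      ∫⁻ w, ENNReal.ofReal (S.nrm ((S.prelim (S.oracle Q w) k).2 - Q.xstar) ^ 2) ∂Q.obsLaw M
        ≤ ENNReal.ofReal ((1 / 2) ^ k * S.R ^ 2 + S.noiseFloor) →
      S.HasError Q (M := M) ((k + 1) * S.m₀) ((1 / 2) ^ (k + 1) * S.R ^ 2 + S.noiseFloor)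
        fun w => S.prelim (S.oracle Q w) (k + 1) := by
    intro k hk hst hle
    have e : (k + 1) * S.m₀ = k * S.m₀ + S.m₀ := by ring
    rw [e] at hk ⊢
    refine hQ.hasError_stage hS hβ le_rfl hst (zero_lt_one.trans hm) hk (by positivity) hle ?_
    have h1 := mul_le_mul_of_nonneg_right (hS.prelim_contraction hm)
      (show 0 ≤ (1 / 2) ^ k * S.R ^ 2 + S.noiseFloor by positivity)
    have h2 : 32 * S.sbar * S.ϰ' * S.ς ^ 2 / (S.κ * (2 * S.ϰ * S.ν)) = S.noiseFloor / 2 := by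
      rw [Setting.noiseFloor]; field_simp
    rw [h2, pow_succ (1 / 2 : ℝ)]
    linarith
  induction k with
  | zero =>
    obtain ⟨h1, h2⟩ := hQ.prelim_start (M := M) hS
    refine key 0 hk (by simpa using h1) (h2.trans (ENNReal.ofReal_le_ofReal ?_))
    simpa using hA
  | succ k ih =>
    have h := ih (le_trans (Nat.mul_le_mul_right _ (by omega)) hk)
    exact key (k + 1) hk h.state_snd h.lintegral_snd

/-- Doubling β halves the noise term, and doubling the length keeps the contraction factor. The new
bound is 4A·2⁻ᵏ/4 + A·2⁻ᵏ⁻¹ = 3A·2⁻ᵏ⁻¹, within the required 4A·2⁻ᵏ⁻¹. -/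
lemma Setting.InClass.hasError_asymp (hS : S.Standing) (hQ : S.InClass Q) (hm : 1 < S.m₀)
    (hstart : S.HasError Q (M := M) (S.K M * S.m₀) (4 * S.noiseFloor)
      fun w => S.prelim (S.oracle Q w) (S.K M))
    {k : ℕ} (hk : S.K M * S.m₀ + ∑ j ∈ Finset.Icc 1 k, S.m j ≤ M) :
    S.HasError Q (M := M) (S.K M * S.m₀ + ∑ j ∈ Finset.Icc 1 k, S.m j)
      (4 * S.noiseFloor * (1 / 2) ^ k) fun w => S.asymp M (S.oracle Q w) k := by
  have hν := hS.ν_pos hm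
  have hϰ := hS.ϰ_pos
  have hκ := hS.κ_pos
  have hA := hS.noiseFloor_nonneg hm
  induction k with
  | zero => simpa [Setting.asymp] using hstart
  | succ k ih =>
    have e : ∑ j ∈ Finset.Icc 1 (k + 1), S.m j = ∑ j ∈ Finset.Icc 1 k, S.m j + S.m (k + 1) :=
      Finset.sum_Icc_succ_top (by omega) _
    rw [e, ← add_assoc] at hk ⊢
    have h := ih (by omega)
    refine hQ.hasError_stage hS (by positivity) ?_ h.state_snd (hS.m_pos hm _) hk (by positivity)
      h.lintegral_snd ?_
    · have h3 : (2 : ℝ) ≤ 2 ^ (k + 1) := by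
        rw [pow_succ]; linarith [one_le_pow₀ (one_le_two (α := ℝ)) (n := k)]
      calc 2 * S.ϰ * S.ν = 2 * (S.ν * S.ϰ) := by ring
        _ ≤ 2 ^ (k + 1) * (S.ν * S.ϰ) := by gcongr
        _ = _ := by ring
    · have h1 := mul_le_mul_of_nonneg_right (hS.asymp_contraction hm (k + 1))
        (show 0 ≤ 4 * S.noiseFloor * (1 / 2) ^ k by positivity)
      have h2 : 32 * S.sbar * S.ϰ' * S.ς ^ 2 / (S.κ * (2 ^ (k + 1) * S.ν * S.ϰ)) =
          S.noiseFloor * (1 / 2) ^ (k + 1) := by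
        rw [Setting.noiseFloor, one_div, inv_pow]; field_simp
      have h4 : 0 ≤ S.noiseFloor * (1 / 2) ^ k := by positivity
      rw [h2]
      rw [pow_succ (1 / 2 : ℝ)]
      linarith

end Multistage

/-! ### Accuracy of the multistage algorithm -/

section Accuracy

variable {E : Type v} [NormedAddCommGroup E] [InnerProductSpace ℝ E] [CompleteSpace E]
  [MeasurableSpace E] {S : Setting E} {Q : Problem.{u} E} {M : ℕ}

lemma Setting.InClass.R_nonneg (hQ : S.InClass Q) : 0 ≤ S.R :=
  (apply_nonneg _ _).trans hQ.xstar_near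

namespace Setting.Standing

lemma sq_le_two_pow_Kbar_mul (hS : S.Standing) (hm : 1 < S.m₀) (hς : S.ς ≠ 0) :
    S.R ^ 2 * (1 / 2) ^ S.Kbar ≤ S.noiseFloor := by
  have hA := hS.noiseFloor_pos hm hς
  rcases eq_or_ne S.R 0 with hR | hR
  · rw [hR]; simpa using hA.le
  have hν := hS.ν_pos hm
  have hϰ := hS.ϰ_pos
  have hκ := hS.κ_pos
  have hs := hS.sbar_pos hm
  have hϰ' := hS.ϰ'_pos
  have e : S.R ^ 2 * S.κ * S.ν * S.ϰ / (32 * S.ς ^ 2 * S.sbar * S.ϰ') = S.R ^ 2 / S.noiseFloor := by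
    rw [Setting.noiseFloor]; field_simp
  have hpos : 0 < S.R ^ 2 / S.noiseFloor := by positivity
  have h1 : Real.logb 2 (S.R ^ 2 / S.noiseFloor) ≤ S.Kbar := by
    rw [Setting.Kbar, e]
    exact (Nat.le_ceil _).trans (by exact_mod_cast le_max_right _ _)
  rw [Real.logb_le_iff_le_rpow one_lt_two hpos, Real.rpow_natCast, div_le_iff₀ hA] at h1
  rw [one_div, inv_pow, ← div_eq_mul_inv, div_le_iff₀ (by positivity)]
  linarith

lemma noiseFloor_le_of_lt_Kbar (hS : S.Standing) (hm : 1 < S.m₀) (hς : S.ς ≠ 0)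
    {k : ℕ} (hk0 : 0 < k) (hk : k < S.Kbar) : S.noiseFloor ≤ S.R ^ 2 * (1 / 2) ^ k := by
  have hA := hS.noiseFloor_pos hm hς
  have hν := hS.ν_pos hm
  have hϰ := hS.ϰ_pos
  have hκ := hS.κ_pos
  have hs := hS.sbar_pos hm
  have hϰ' := hS.ϰ'_pos
  have e : S.R ^ 2 * S.κ * S.ν * S.ϰ / (32 * S.ς ^ 2 * S.sbar * S.ϰ') = S.R ^ 2 / S.noiseFloor := by
    rw [Setting.noiseFloor]; field_simp
  have h1 : (k : ℝ) < Real.logb 2 (S.R ^ 2 / S.noiseFloor) := by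
    rw [Setting.Kbar, e, lt_max_iff] at hk
    rcases hk with hk | hk
    · omega
    · exact Nat.lt_ceil.mp hk
  -- If R = 0 the logarithm has the default value 0, which is not above k.
  have hpos : 0 < S.R ^ 2 / S.noiseFloor := by
    refine lt_of_le_of_ne (by positivity) fun h => ?_
    rw [← h, Real.logb_zero] at h1
    exact absurd h1 (not_lt.mpr (Nat.cast_nonneg k))
  rw [Real.lt_logb_iff_rpow_lt one_lt_two hpos, Real.rpow_natCast, lt_div_iff₀ hA] at h1
  rw [one_div, inv_pow, ← div_eq_mul_inv, le_div_iff₀ (by positivity)]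
  linarith

/-- With m₀ ≤ 320T the hypothesis gives M/(1280T) ≤ k/2, and 1/2 ≤ exp(−1/2). -/
lemma half_pow_le_exp (hS : S.Standing) (hm : 1 < S.m₀) {k : ℕ} (hk : M ≤ 2 * S.m₀ * k) :
    (1 / 2 : ℝ) ^ k ≤ Real.exp (-(M / (1280 * S.stageCost))) := by
  have hT := hS.stageCost_pos hm
  have h1 : (M : ℝ) ≤ 2 * S.m₀ * k := by exact_mod_cast hk
  have h2 := hS.m₀_le hm
  have h3 : (M : ℝ) / (1280 * S.stageCost) ≤ k / 2 := by
    rw [div_le_iff₀ (by positivity)]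
    have : (0 : ℝ) ≤ k := Nat.cast_nonneg k
    nlinarith
  have h4 : (1 / 2 : ℝ) ≤ Real.exp (-(1 / 2)) := by
    have := Real.add_one_le_exp (-(1 / 2) : ℝ)
    linarith
  calc (1 / 2 : ℝ) ^ k ≤ Real.exp (-(1 / 2)) ^ k := pow_le_pow_left₀ (by norm_num) h4 k
    _ = Real.exp (-(k / 2)) := by rw [← Real.exp_nat_mul]; congr 1; ring
    _ ≤ _ := Real.exp_le_exp.mpr (by linarith)

lemma K'_spec {E : Type v} [NormedAddCommGroup E] [InnerProductSpace ℝ E] (S : Setting E)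
    (k : ℕ) : ∑ j ∈ Finset.Icc 1 (S.K' k), S.m j ≤ k :=
  Nat.findGreatest_spec (P := fun i => ∑ j ∈ Finset.Icc 1 i, S.m j ≤ k) (Nat.zero_le k) (by simp)

/-- Each stage has length at least 1, so the bounded search that defines `K'` cannot miss a feasible
number of stages. -/
lemma lt_sum_m (hS : S.Standing) (hm : 1 < S.m₀) (k : ℕ) :
    k < ∑ j ∈ Finset.Icc 1 (S.K' k + 1), S.m j := by
  by_contra! hcon
  have h1 : ∑ j ∈ Finset.Icc 1 (S.K' k + 1), 1 ≤ ∑ j ∈ Finset.Icc 1 (S.K' k + 1), S.m j :=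
    Finset.sum_le_sum fun j _ => hS.m_pos hm j
  simp only [Finset.sum_const, Nat.card_Icc, smul_eq_mul, mul_one] at h1
  exact Nat.findGreatest_is_greatest (P := fun i => ∑ j ∈ Finset.Icc 1 i, S.m j ≤ k)
    (Nat.lt_succ_self (S.K' k)) (by omega) hcon

end Setting.Standing

/-- The bound for the mean square error of the algorithm with `M` observations. -/
def Setting.errBound (S : Setting E) (M : ℕ) : ℝ :=
  21504 * (S.R ^ 2 * Real.exp (-(M / (1280 * S.stageCost)))
    + S.noiseFloor * (S.stageCost / M))

lemma Setting.HasError.mono {E : Type v} [NormedAddCommGroup E] [InnerProductSpace ℝ E]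
    [MeasurableSpace E] {S : Setting E} {Q : Problem.{u} E} {M n : ℕ} {ρ ρ' : ℝ}
    {z : (Fin M → Q.Ω) → E × E}
    (h : S.HasError Q n ρ z) (hρ : ρ ≤ ρ') : S.HasError Q n ρ' z where
  state_fst := h.state_fst
  state_snd := h.state_snd
  lintegral_fst := h.lintegral_fst.trans (ENNReal.ofReal_le_ofReal hρ)
  lintegral_snd := h.lintegral_snd.trans (ENNReal.ofReal_le_ofReal hρ)

variable [FiniteDimensional ℝ E] [BorelSpace E]

/-- If ς = 0 or fewer than K̄ preliminary stages fit, the error is dominated by R²2⁻ᴷ, with K of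
order at least M/m₀. If K̄ stages fit but take more than half of the observations, `hsmall` applies.
Otherwise the asymptotic phase has at least half of them, and since one more stage would not fit,
2⁻ᵏ is of order T/M. -/
lemma Setting.InClass.exists_hasError_smdSR (hS : S.Standing) (hQ : S.InClass Q) (hm : 1 < S.m₀)
    (hM : S.m₀ ≤ M) :
    ∃ n, S.HasError Q (M := M) n (S.errBound M) fun w => S.smdSR M (S.oracle Q w) := by
  have hm0 : 0 < S.m₀ := zero_lt_one.trans hm
  have hT := hS.stageCost_pos hm
  have hA := hS.noiseFloor_nonneg hm
  have hM0 : (0 : ℝ) < M := by exact_mod_cast hm0.trans_le hM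
  set ex := Real.exp (-(M / (1280 * S.stageCost))) with hex
  have hex0 : 0 < ex := Real.exp_pos _
  have hAT : 0 ≤ S.noiseFloor * (S.stageCost / M) := by positivity
  have hRe : 0 ≤ S.R ^ 2 * ex := by positivity
  have hq : 0 < M / S.m₀ := Nat.div_pos hM hm0
  -- Rounding down a quotient that is at least 1 loses at most a factor 2.
  have hqM : M ≤ 2 * S.m₀ * (M / S.m₀) := by
    have h1 := Nat.div_add_mod M S.m₀
    have h2 := Nat.mod_lt M hm0
    have h3 : S.m₀ * 1 ≤ S.m₀ * (M / S.m₀) := Nat.mul_le_mul_left _ hq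
    rw [mul_assoc]
    omega
  have hpre : ∀ k, 0 < k → k * S.m₀ ≤ M → S.HasError Q (M := M) (k * S.m₀)
      ((1 / 2) ^ k * S.R ^ 2 + S.noiseFloor) fun w => S.prelim (S.oracle Q w) k := by
    intro k hk hkM
    obtain ⟨j, rfl⟩ : ∃ j, k = j + 1 := ⟨k - 1, by omega⟩
    exact hQ.hasError_prelim hS hm hkM
  by_cases hς : S.ς = 0
  · have hK : S.K M = M / S.m₀ := by simp [Setting.K, hς]
    have hA0 : S.noiseFloor = 0 := by simp [Setting.noiseFloor, hς]
    refine ⟨M / S.m₀ * S.m₀, ?_⟩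
    simp only [Setting.smdSR, hς, ne_eq, not_true_eq_false, false_and, if_false, hK]
    refine (hpre _ hq (Nat.div_mul_le_self _ _)).mono ?_
    have := mul_le_mul_of_nonneg_left (hS.half_pow_le_exp hm hqM) (sq_nonneg S.R)
    rw [Setting.errBound]
    linarith
  have hK : S.K M = min (M / S.m₀) S.Kbar := by simp [Setting.K, hς]
  have hKb : 1 ≤ S.Kbar := le_max_left _ _
  have hup := hS.sq_le_two_pow_Kbar_mul hm hς
  rcases lt_or_ge (M / S.m₀) S.Kbar with hlt | hge
  · have hcond : ¬(S.ς ≠ 0 ∧ S.m₀ * S.Kbar + S.m 1 ≤ M) := fun h => by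
      have := (Nat.le_div_iff_mul_le hm0).mpr (show S.Kbar * S.m₀ ≤ M by
        rw [mul_comm]; omega)
      omega
    rw [min_eq_left hlt.le] at hK
    refine ⟨M / S.m₀ * S.m₀, ?_⟩
    simp only [Setting.smdSR, if_neg hcond, hK]
    refine (hpre _ hq (Nat.div_mul_le_self _ _)).mono ?_
    have h1 := hS.noiseFloor_le_of_lt_Kbar hm hς hq hlt
    have h2 := mul_le_mul_of_nonneg_left (hS.half_pow_le_exp hm hqM) (sq_nonneg S.R)
    rw [Setting.errBound]
    linarith
  rw [min_eq_right hge] at hK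
  have hKM : S.Kbar * S.m₀ ≤ M := (Nat.le_div_iff_mul_le hm0).mp hge
  have hstart := hpre _ hKb hKM
  have hsmall : M < 2 * S.m₀ * S.Kbar → 4 * S.noiseFloor ≤ S.errBound M := by
    intro hMK
    rw [Setting.errBound]
    -- If K̄ = 1 the logarithm may be negative and gives no lower bound for R, but then M is at most
    -- 2m₀, so T/M is bounded below. If K̄ > 1, then K̄ − 1 halvings of R² do not reach A.
    rcases hKb.eq_or_lt with h1 | h1
    · rw [← h1] at hMK
      have h2 : (M : ℝ) ≤ 2 * S.m₀ * 1 := by exact_mod_cast hMK.le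
      have h3 : (M : ℝ) ≤ 640 * S.stageCost := by linarith [hS.m₀_le hm]
      have h4 : 1 ≤ 640 * (S.stageCost / M) := by
        rw [mul_div_assoc', le_div_iff₀ hM0]; linarith
      have := mul_le_mul_of_nonneg_left h4 hA
      linarith
    · have h2 := hS.noiseFloor_le_of_lt_Kbar hm hς (k := S.Kbar - 1) (by omega) (by omega)
      have h3 := mul_le_mul_of_nonneg_left (hS.half_pow_le_exp hm hMK.le) (sq_nonneg S.R)
      have h4 : (1 / 2 : ℝ) ^ (S.Kbar - 1) = 2 * (1 / 2) ^ S.Kbar := by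
        obtain ⟨j, hj⟩ : ∃ j, S.Kbar = j + 1 := ⟨S.Kbar - 1, by omega⟩
        rw [hj, pow_succ, Nat.add_sub_cancel]; ring
      rw [h4] at h2
      linarith
  by_cases hcond : S.ς ≠ 0 ∧ S.m₀ * S.Kbar + S.m 1 ≤ M
  · have hspec := Setting.Standing.K'_spec S (M - S.m₀ * S.Kbar)
    have hlt := hS.lt_sum_m hm (M - S.m₀ * S.Kbar)
    set k := S.K' (M - S.m₀ * S.Kbar) with hk
    have hle : S.K M * S.m₀ + ∑ j ∈ Finset.Icc 1 k, S.m j ≤ M := by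
      rw [hK, mul_comm]; omega
    have hstart' : S.HasError Q (M := M) (S.K M * S.m₀) (4 * S.noiseFloor)
        fun w => S.prelim (S.oracle Q w) (S.K M) := by
      rw [hK]
      exact hstart.mono (by linarith)
    have h := hQ.hasError_asymp hS hm hstart' hle
    refine ⟨S.K M * S.m₀ + ∑ j ∈ Finset.Icc 1 k, S.m j, ?_⟩
    simp only [Setting.smdSR, if_pos hcond]
    refine h.mono ?_
    rcases lt_or_ge M (2 * S.m₀ * S.Kbar) with h1 | h1
    · refine le_trans ?_ (hsmall h1)
      exact mul_le_of_le_one_right (by positivity) (pow_le_one₀ (by norm_num) (by norm_num))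
    · have h2 : M < 2 * ∑ j ∈ Finset.Icc 1 (k + 1), S.m j := by
        rw [mul_assoc] at h1; omega
      have h3 : (M : ℝ) < 2 * ((∑ j ∈ Finset.Icc 1 (k + 1), S.m j : ℕ) : ℝ) := by exact_mod_cast h2
      have h4 := hS.sum_m_le hm (k + 1)
      have h5 : (1 / 2 : ℝ) ^ k ≤ 5376 * (S.stageCost / M) := by
        rw [one_div, inv_pow, mul_div_assoc', le_div_iff₀ hM0, inv_mul_le_iff₀ (by positivity)]
        rw [pow_succ] at h4
        linarith
      have h6 := mul_le_mul_of_nonneg_left h5 hA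
      rw [Setting.errBound]
      linarith
  · refine ⟨S.Kbar * S.m₀, ?_⟩
    simp only [Setting.smdSR, if_neg hcond, hK]
    refine hstart.mono (show _ ≤ 2 * S.noiseFloor by linarith) |>.mono ?_
    rcases lt_or_ge M (2 * S.m₀ * S.Kbar) with h1 | h1
    · exact le_trans (by linarith) (hsmall h1)
    · have h2 : M < 2 * S.m 1 := by
        have : ¬(S.m₀ * S.Kbar + S.m 1 ≤ M) := fun h => hcond ⟨hς, h⟩
        rw [mul_assoc] at h1; omega
      have h3 : (M : ℝ) < 2 * S.m 1 := by exact_mod_cast h2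
      have h4 := hS.m_le hm 1
      have h5 : 1 ≤ 2688 * (S.stageCost / M) := by
        rw [mul_div_assoc', le_div_iff₀ hM0]; linarith
      have h6 := mul_le_mul_of_nonneg_left h5 hA
      rw [Setting.errBound]
      linarith

end Accuracy

/-! ### Aggregation of points most of which are good -/

section Aggregation

variable {E : Type v} [NormedAddCommGroup E] {L : ℕ} {z : Fin L → E} {x xs : E} {ρ : ℝ}

open Classical in
-- Put d = ‖x − xs‖. Replacing u by x raises the distance to a good point by at least d − 3ρ and
-- lowers that to a bad point by at most d + ρ. With fewer than a third of the points bad and no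
-- increase in total, d cannot exceed 7ρ.
lemma norm_sub_lt_of_sum_le {u : E} (hu : ‖u - xs‖ < ρ)
    (hbad : 3 * (Finset.univ.filter fun l => ρ ≤ ‖z l - xs‖).card < L)
    (hsum : ∑ l, ‖x - z l‖ ≤ ∑ l, ‖u - z l‖) : ‖x - xs‖ < 8 * ρ := by
  have hρ : 0 < ρ := (norm_nonneg _).trans_lt hu
  set bad := Finset.univ.filter fun l => ρ ≤ ‖z l - xs‖ with hb
  have hpt : ∀ l, ‖x - xs‖ - 3 * ρ - (if ρ ≤ ‖z l - xs‖ then 2 * ‖x - xs‖ - 2 * ρ else 0)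
      ≤ ‖x - z l‖ - ‖u - z l‖ := fun l => by
    split_ifs with h
    · have h1 := norm_sub_le_norm_sub_add_norm_sub u x (z l)
      have h2 := norm_sub_le_norm_sub_add_norm_sub u xs x
      rw [norm_sub_rev xs x] at h2
      linarith
    · have h1 := norm_sub_le_norm_sub_add_norm_sub x (z l) xs
      have h2 := norm_sub_le_norm_sub_add_norm_sub u xs (z l)
      rw [norm_sub_rev xs (z l)] at h2
      linarith
  have h := Finset.sum_le_sum fun l (_ : l ∈ Finset.univ) => hpt l
  rw [Finset.sum_sub_distrib (fun l => ‖x - z l‖), Finset.sum_sub_distrib, ← Finset.sum_filter,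
    Finset.sum_const, Finset.sum_const, ← hb, Finset.card_univ, Fintype.card_fin, nsmul_eq_mul,
    nsmul_eq_mul] at h
  have hcard : 3 * (bad.card : ℝ) + 1 ≤ L := by exact_mod_cast hbad
  have hc0 : (0 : ℝ) ≤ bad.card := Nat.cast_nonneg _
  by_contra! hcon
  have h1 : 0 ≤ (L - 3 * (bad.card : ℝ)) * (‖x - xs‖ - ρ) :=
    mul_nonneg (by linarith) (by linarith)
  have h2 : 0 < (L : ℝ) * (‖x - xs‖ - 7 * ρ) := mul_pos (by linarith) (by linarith)
  nlinarith

lemma orderStat_set_bddBelow (i : Fin L) {k : ℕ} (hk : 0 < k) :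
    BddBelow {t : ℝ | k ≤ Set.ncard {j : Fin L | j ≠ i ∧ ‖z i - z j‖ ≤ t}} := by
  refine ⟨0, fun t ht => ?_⟩
  obtain ⟨j, hj⟩ := Set.nonempty_of_ncard_ne_zero (hk.trans_le ht).ne'
  exact (norm_nonneg _).trans hj.2

open Classical in
-- The good points lie within 2ρ of each other and form a sufficient majority, so the optimal order
-- statistic is at most 2ρ. More than L/2 points are then within 3ρ of z i, and one of them is good.
lemma orderStat_output_lt (hL : 12 ≤ L)
    (hbad : 3 * (Finset.univ.filter fun l => ρ ≤ ‖z l - xs‖).card < L) {i : Fin L}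
    (hi : ∀ j, orderStat z i (L / 2 + 1) ≤ orderStat z j (L / 2 + 1)) :
    ‖z i - xs‖ < 8 * ρ := by
  set bad := Finset.univ.filter fun l => ρ ≤ ‖z l - xs‖ with hb
  have hgood : (Finset.univ.filter fun l => ‖z l - xs‖ < ρ).card + bad.card = L := by
    have := Finset.card_filter_add_card_filter_not (s := (Finset.univ : Finset (Fin L)))
      (fun l => ‖z l - xs‖ < ρ)
    simpa only [not_lt, Finset.card_univ, Fintype.card_fin] using this
  set good := Finset.univ.filter fun l => ‖z l - xs‖ < ρ with hg
  obtain ⟨a, ha⟩ : good.Nonempty := Finset.card_pos.mp (by omega)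
  have ha' : ‖z a - xs‖ < ρ := (Finset.mem_filter.mp ha).2
  have hρ : 0 < ρ := (norm_nonneg _).trans_lt ha'
  have h1 : orderStat z a (L / 2 + 1) ≤ 2 * ρ := by
    refine csInf_le (orderStat_set_bddBelow a (Nat.succ_pos _)) ?_
    have hsub : ((good.erase a : Finset (Fin L)) : Set (Fin L)) ⊆
        {j : Fin L | j ≠ a ∧ ‖z a - z j‖ ≤ 2 * ρ} := fun j hj => by
      rw [Finset.mem_coe, Finset.mem_erase] at hj
      refine ⟨hj.1, ?_⟩
      have h3 := norm_sub_le_norm_sub_add_norm_sub (z a) xs (z j)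
      have h4 : ‖z j - xs‖ < ρ := (Finset.mem_filter.mp hj.2).2
      rw [norm_sub_rev xs] at h3
      linarith
    have h2 := Set.ncard_le_ncard hsub (Set.toFinite _)
    rw [Set.ncard_coe_finset, Finset.card_erase_of_mem ha] at h2
    exact le_trans (by omega) h2
  have hne : {t : ℝ | L / 2 + 1 ≤ Set.ncard {j : Fin L | j ≠ i ∧ ‖z i - z j‖ ≤ t}}.Nonempty := by
    refine ⟨∑ j, ‖z i - z j‖, ?_⟩
    have e : {j : Fin L | j ≠ i ∧ ‖z i - z j‖ ≤ ∑ j, ‖z i - z j‖} =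
        ((Finset.univ.erase i : Finset (Fin L)) : Set (Fin L)) := by
      ext j
      simp only [Set.mem_ofPred_eq, Finset.coe_erase, Finset.coe_univ, Set.mem_sdiff, Set.mem_univ,
        Set.mem_singleton_iff, true_and]
      exact and_iff_left (Finset.single_le_sum (f := fun j => ‖z i - z j‖)
        (fun _ _ => norm_nonneg _) (Finset.mem_univ j))
    change L / 2 + 1 ≤ _
    rw [e, Set.ncard_coe_finset, Finset.card_erase_of_mem (Finset.mem_univ i), Finset.card_univ,
      Fintype.card_fin]
    omega
  -- The passage from 2ρ to 3ρ avoids showing that the infimum is attained.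
  obtain ⟨t, ht, ht3⟩ := exists_lt_of_csInf_lt hne
    (show sInf _ < 3 * ρ from ((hi a).trans h1).trans_lt (by linarith))
  obtain ⟨j, hj, hjb⟩ : ∃ j ∈ {j : Fin L | j ≠ i ∧ ‖z i - z j‖ ≤ t}, j ∉ (bad : Set (Fin L)) := by
    by_contra! hcon
    have h2 := Set.ncard_le_ncard (fun j hj => hcon j hj) (Set.toFinite (bad : Set (Fin L)))
    rw [Set.ncard_coe_finset] at h2
    have h3 : L / 2 + 1 ≤ _ := ht
    omega
  have hj' : ‖z j - xs‖ < ρ := by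
    by_contra! hcon
    exact hjb (by simp [hb, hcon])
  have := norm_sub_le_norm_sub_add_norm_sub (z i) (z j) xs
  linarith [hj.2]

open Classical in
lemma Rule.IsOutput.norm_sub_lt {rule : Rule} (hout : rule.IsOutput z x) (hL : 12 ≤ L)
    (hρ : 0 < ρ) (hbad : 3 * (Finset.univ.filter fun l => ρ ≤ ‖z l - xs‖).card < L) :
    ‖x - xs‖ < 8 * ρ := by
  cases rule with
  | geometric =>
    exact norm_sub_lt_of_sum_le (u := xs) (by simpa using hρ) hbad (hout (Set.mem_univ xs))
  | empirical =>
    obtain ⟨a, ha⟩ : ∃ a, ‖z a - xs‖ < ρ := by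
      by_contra! hcon
      simp [hcon] at hbad
      omega
    exact norm_sub_lt_of_sum_le ha hbad (hout.2 (Set.mem_range_self a))
  | distance =>
    obtain ⟨i, rfl, hi⟩ := hout
    exact orderStat_output_lt hL hbad hi

/-- The map `sparse` is controlled on X only. A geometric median outside X could be improved: its
projection onto X is strictly closer to every point of X. -/
lemma Rule.IsOutput.mem [InnerProductSpace ℝ E] [CompleteSpace E] {rule : Rule}
    (hout : rule.IsOutput z x) (hL : 0 < L) {X : Set E} (hX : Convex ℝ X) (hcl : IsClosed X)
    (hz : ∀ l, z l ∈ X) : x ∈ X := by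
  cases rule with
  | geometric =>
    obtain ⟨q, hq, hqmin⟩ := exists_norm_eq_iInf_of_complete_convex ⟨_, hz ⟨0, hL⟩⟩
      hcl.isComplete hX x
    rw [norm_eq_iInf_iff_real_inner_le_zero hX hq] at hqmin
    rcases eq_or_ne x q with rfl | hne
    · exact hq
    exfalso
    have hlt : ∀ l, ‖q - z l‖ < ‖x - z l‖ := fun l => by
      have h1 := hqmin _ (hz l)
      have h2 : 0 < ‖x - q‖ := norm_pos_iff.mpr (sub_ne_zero.mpr hne)
      have h3 : x - z l = (x - q) - (z l - q) := by abel
      have h4 := norm_sub_sq_real (x - q) (z l - q)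
      rw [← h3, norm_sub_rev (z l)] at h4
      exact lt_of_pow_lt_pow_left₀ 2 (norm_nonneg _) (by nlinarith)
    have hle : ∑ l, ‖x - z l‖ ≤ ∑ l, ‖q - z l‖ := hout (Set.mem_univ q)
    exact absurd hle (not_le.mpr (Finset.sum_lt_sum_of_nonempty ⟨⟨0, hL⟩, Finset.mem_univ _⟩
      fun l _ => hlt l))
  | empirical =>
    obtain ⟨l, rfl⟩ := hout.1
    exact hz l
  | distance =>
    obtain ⟨i, rfl, -⟩ := hout
    exact hz i

end Aggregation

/-! ### Reliable solutions -/

open Classical in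
-- Union bound over the sets T of at least L/3 indices: there are at most 2ᴸ of them, and all runs
-- in T fall into B with probability at most (q³)^|T| ≤ qᴸ. Writing the bound for B as a cube avoids
-- fractional powers.
lemma measure_pi_many_mem_le {W : Type*} [MeasurableSpace W] (μ : Measure W)
    [IsProbabilityMeasure μ] {L : ℕ} {B : Set W} {q : ℝ≥0∞} (hq : q ≤ 1) (hB : μ B ≤ q ^ 3) :
    Measure.pi (fun _ : Fin L => μ)
      {w | L ≤ 3 * (Finset.univ.filter fun l => w l ∈ B).card} ≤ (2 * q) ^ L := by
  set 𝒯 : Finset (Finset (Fin L)) := Finset.univ.filter fun T => L ≤ 3 * T.card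
  have hsub : {w : Fin L → W | L ≤ 3 * (Finset.univ.filter fun l => w l ∈ B).card} ⊆
      ⋃ T ∈ 𝒯, Set.univ.pi fun l => if l ∈ T then B else Set.univ := fun w hw => by
    refine Set.mem_biUnion (x := Finset.univ.filter fun l => w l ∈ B)
      (Finset.mem_coe.mpr (Finset.mem_filter.mpr ⟨Finset.mem_univ _, hw⟩)) fun l _ => ?_
    dsimp only
    split_ifs with h
    · exact (Finset.mem_filter.mp h).2
    · trivial
  have hT : ∀ T ∈ 𝒯, Measure.pi (fun _ : Fin L => μ)
      (Set.univ.pi fun l => if l ∈ T then B else Set.univ) ≤ q ^ L := fun T hT => by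
    have hT' : L ≤ 3 * T.card := (Finset.mem_filter.mp hT).2
    rw [Measure.pi_pi]
    calc ∏ l, μ (if l ∈ T then B else Set.univ) = ∏ l, if l ∈ T then μ B else 1 :=
          Finset.prod_congr rfl fun l _ => by split_ifs <;> simp
      _ = μ B ^ T.card := by
          rw [← Finset.prod_filter, Finset.filter_mem_eq_inter, Finset.univ_inter,
            Finset.prod_const]
      _ ≤ (q ^ 3) ^ T.card := by gcongr
      _ = q ^ (3 * T.card) := (pow_mul _ _ _).symm
      _ ≤ q ^ L := pow_le_pow_right_of_le_one' hq hT'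
  calc _ ≤ Measure.pi (fun _ : Fin L => μ)
        (⋃ T ∈ 𝒯, Set.univ.pi fun l => if l ∈ T then B else Set.univ) := measure_mono hsub
    _ ≤ ∑ T ∈ 𝒯, Measure.pi (fun _ : Fin L => μ)
        (Set.univ.pi fun l => if l ∈ T then B else Set.univ) := measure_biUnion_finset_le _ _
    _ ≤ ∑ _T ∈ 𝒯, q ^ L := Finset.sum_le_sum hT
    _ ≤ ∑ _T : Finset (Fin L), q ^ L :=
        Finset.sum_le_sum_of_subset (Finset.subset_univ _)
    _ = _ := by
        rw [Finset.sum_const, Finset.card_univ, Fintype.card_finset, Fintype.card_fin,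
          nsmul_eq_mul, mul_pow]
        push_cast
        rfl

lemma fifth_pow_le {ε : ℝ} (hε : 0 < ε) {L : ℕ} (hL : Real.log (1 / ε) ≤ L) :
    (1 / 5 : ℝ) ^ L ≤ ε := by
  have h1 : (1 / 5 : ℝ) ≤ Real.exp (-1) := by
    rw [Real.exp_neg, one_div]
    exact inv_anti₀ (Real.exp_pos 1) (by linarith [Real.exp_one_lt_d9])
  calc (1 / 5 : ℝ) ^ L ≤ Real.exp (-1) ^ L := pow_le_pow_left₀ (by norm_num) h1 L
    _ = Real.exp (-L) := by rw [← Real.exp_nat_mul]; congr 1; ring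
    _ ≤ Real.exp (Real.log ε) := Real.exp_le_exp.mpr (by
        rw [one_div, Real.log_inv] at hL; linarith)
    _ = ε := Real.exp_log hε

/-! ### Comparison of risks -/

section Risk

variable {E : Type v} [NormedAddCommGroup E] {L M : ℕ} {ε : ℝ} {𝒳 : Set (Problem.{u} E)}

lemma epsRisk_le_of_forall {q : E → ℝ} {est : Estimator.{u} E L M} {r : ℝ≥0∞}
    (h : ∀ Q ∈ 𝒳, Q.sampleLaw L M {w | r ≤ ENNReal.ofReal (q (est Q w - Q.xstar))} ≤
      ENNReal.ofReal ε) :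
    epsRisk q ε 𝒳 est ≤ r :=
  sInf_le (Set.mem_ofPred.mpr (iSup₂_le h))

lemma epsRisk_le_ofReal_mul {q q' : E → ℝ} {est est' : Estimator.{u} E L M} {a : ℝ} (ha : 0 ≤ a)
    (h : ∀ Q ∈ 𝒳, ∀ w, q (est Q w - Q.xstar) ≤ a * q' (est' Q w - Q.xstar)) :
    epsRisk q ε 𝒳 est ≤ ENNReal.ofReal a * epsRisk q' ε 𝒳 est' := by
  -- A zero factor (the case s = 0) cannot be cancelled; there the error is nonpositive, and every
  -- level r > 0 has an empty event.
  rcases ha.eq_or_lt with rfl | ha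
  · rw [ENNReal.ofReal_zero, zero_mul]
    refine le_of_forall_gt_imp_ge_of_dense fun r hr => epsRisk_le_of_forall fun Q hQ => ?_
    have he : {w | r ≤ ENNReal.ofReal (q (est Q w - Q.xstar))} = ∅ := by
      refine Set.eq_empty_of_forall_notMem fun w hw => ?_
      have h1 := h Q hQ w
      rw [zero_mul] at h1
      have h2 : r ≤ ENNReal.ofReal (q (est Q w - Q.xstar)) := hw
      rw [ENNReal.ofReal_of_nonpos h1] at h2
      exact absurd hr (not_lt.mpr h2)
    rw [he, measure_empty]
    exact zero_le
  have ha0 : ENNReal.ofReal a ≠ 0 := (ENNReal.ofReal_pos.mpr ha).ne'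
  rw [← ENNReal.div_le_iff' ha0 ENNReal.ofReal_ne_top]
  refine le_sInf fun r hr => ?_
  rw [ENNReal.div_le_iff' ha0 ENNReal.ofReal_ne_top]
  refine epsRisk_le_of_forall fun Q hQ => (measure_mono fun w hw => ?_).trans
    ((le_iSup₂ (f := fun (Q : Problem.{u} E) (_ : Q ∈ 𝒳) => Q.sampleLaw L M
      {w | r ≤ ENNReal.ofReal (q' (est' Q w - Q.xstar))}) Q hQ).trans hr)
  have h1 : ENNReal.ofReal a * r ≤ ENNReal.ofReal a * ENNReal.ofReal (q' (est' Q w - Q.xstar)) := by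
    rw [← ENNReal.ofReal_mul ha.le]
    exact le_trans hw (ENNReal.ofReal_le_ofReal (h Q hQ w))
  exact (ENNReal.mul_le_mul_iff_right ha0 ENNReal.ofReal_ne_top).mp h1

end Risk

/-! ### Confidence of the aggregated solution -/

section Reliable

variable {E : Type v} [NormedAddCommGroup E] [InnerProductSpace ℝ E] [CompleteSpace E]
  [MeasurableSpace E] [FiniteDimensional ℝ E] [BorelSpace E] {S : Setting E} {Q : Problem.{u} E}
  {L M : ℕ} {ε : ℝ}

lemma Setting.InClass.xhat_mem (hS : S.Standing) (hQ : S.InClass Q) (hm : 1 < S.m₀)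
    (hM : S.m₀ ≤ M) (w : Fin M → Q.Ω) : S.xhat Q w ∈ S.X := by
  obtain ⟨n, h⟩ := hQ.exists_hasError_smdSR hS hm hM
  exact h.state_fst.mem w

/-- Markov's inequality for the squared error; 1/1000 is written as the cube needed for the union
bound. -/
lemma Setting.InClass.measure_xhat_far_le (hS : S.Standing) (hQ : S.InClass Q) (hm : 1 < S.m₀)
    (hM : S.m₀ ≤ M) {ρ : ℝ} (hρ : 0 < ρ) (hρe : 1000 * S.errBound M ≤ 8 * S.sbar * ρ ^ 2) :
    Q.obsLaw M {w | ρ ≤ ‖S.xhat Q w - Q.xstar‖} ≤ ENNReal.ofReal (1 / 10) ^ 3 := by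
  obtain ⟨n, h⟩ := hQ.exists_hasError_smdSR hS hm hM
  have hs := hS.sbar_pos hm
  have hmeas : Measurable fun w : Fin M → Q.Ω =>
      ENNReal.ofReal (8 * S.sbar * ‖S.xhat Q w - Q.xstar‖ ^ 2) :=
    (((h.state_fst.measurable.sub_const _).norm.pow_const 2).const_mul _).ennreal_ofReal
  have h1 := mul_meas_ge_le_lintegral (μ := Q.obsLaw M) hmeas
    (ENNReal.ofReal (8 * S.sbar * ρ ^ 2))
  have hc : 0 < 8 * S.sbar * ρ ^ 2 := by positivity
  have h2 : Q.obsLaw M {w | ρ ≤ ‖S.xhat Q w - Q.xstar‖} ≤ Q.obsLaw M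
      {w | ENNReal.ofReal (8 * S.sbar * ρ ^ 2) ≤
        ENNReal.ofReal (8 * S.sbar * ‖S.xhat Q w - Q.xstar‖ ^ 2)} :=
    measure_mono fun w (hw : ρ ≤ _) => ENNReal.ofReal_le_ofReal (by gcongr)
  have h3 : ENNReal.ofReal (8 * S.sbar * ρ ^ 2) * Q.obsLaw M {w | ρ ≤ ‖S.xhat Q w - Q.xstar‖} ≤
      ENNReal.ofReal (8 * S.sbar * ρ ^ 2) * ENNReal.ofReal (1 / 10) ^ 3 := by
    refine (mul_le_mul_right h2 _).trans (h1.trans (h.lintegral_fst.trans ?_))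
    rw [← ENNReal.ofReal_pow (by norm_num), ← ENNReal.ofReal_mul hc.le]
    exact ENNReal.ofReal_le_ofReal (by linarith)
  exact (ENNReal.mul_le_mul_iff_right (ENNReal.ofReal_pos.mpr hc).ne' ENNReal.ofReal_ne_top).mp h3

/-- The event of a large error is contained in the event that at least a third of the runs are bad,
so monotonicity of the measure suffices and `xbar` may be any selection, measurable or not. -/
lemma epsRisk_aggregate_le (hS : S.Standing) (hm : 1 < S.m₀) (hM : S.m₀ ≤ M) {rule : Rule}
    {xbar : Estimator.{u} E L M}
    (hx : ∀ Q ∈ S.problems, ∀ w, rule.IsOutput (fun l => S.xhat Q (w l)) (xbar Q w))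
    (hL : 12 ≤ L) (hε : 0 < ε) (hLε : Real.log (1 / ε) ≤ L) {ρ : ℝ} (hρ : 0 < ρ)
    (hρe : 1000 * S.errBound M ≤ 8 * S.sbar * ρ ^ 2) :
    epsRisk norm ε S.problems xbar ≤ ENNReal.ofReal (8 * ρ) := by
  classical
  refine epsRisk_le_of_forall fun Q hQ => ?_
  have h1 := measure_pi_many_mem_le (Q.obsLaw M) (L := L)
    (ENNReal.ofReal_le_one.mpr (by norm_num : (1 / 10 : ℝ) ≤ 1))
    (Setting.InClass.measure_xhat_far_le hS hQ hm hM hρ hρe)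
  have h2 : Q.sampleLaw L M {w | ENNReal.ofReal (8 * ρ) ≤
      ENNReal.ofReal ‖xbar Q w - Q.xstar‖} ≤ _ :=
    (measure_mono fun w hw => ?_).trans h1
  · refine h2.trans ?_
    have e : (2 : ℝ≥0∞) * ENNReal.ofReal (1 / 10) = ENNReal.ofReal (1 / 5) := by
      rw [← ENNReal.ofReal_ofNat, ← ENNReal.ofReal_mul (by norm_num)]
      norm_num
    rw [e, ← ENNReal.ofReal_pow (by norm_num)]
    exact ENNReal.ofReal_le_ofReal (fifth_pow_le hε hLε)
  · have hw' : 8 * ρ ≤ ‖xbar Q w - Q.xstar‖ :=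
      (ENNReal.ofReal_le_ofReal_iff (norm_nonneg _)).mp hw
    by_contra hcon
    have hcon' : 3 * (Finset.univ.filter fun l => ρ ≤ ‖S.xhat Q (w l) - Q.xstar‖).card < L := by
      simpa using hcon
    exact absurd ((hx Q hQ w).norm_sub_lt hL hρ hcon') (not_lt.mpr hw')

lemma epsRisk_aggregate_le_sqrt (hS : S.Standing) (hm : 1 < S.m₀) (hM : S.m₀ ≤ M) {rule : Rule}
    {xbar : Estimator.{u} E L M}
    (hx : ∀ Q ∈ S.problems, ∀ w, rule.IsOutput (fun l => S.xhat Q (w l)) (xbar Q w))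
    (hL : 12 ≤ L) (hε : 0 < ε) (hLε : Real.log (1 / ε) ≤ L) (he : 0 ≤ S.errBound M) :
    epsRisk norm ε S.problems xbar ≤ ENNReal.ofReal (8 * √(125 * S.errBound M / S.sbar)) := by
  have hs := hS.sbar_pos hm
  -- The error bound may vanish while ρ has to be positive, hence the extra η/8.
  refine ENNReal.le_of_forall_pos_le_add fun η hη _ => ?_
  have hη' : (0 : ℝ) < η := hη
  refine (epsRisk_aggregate_le hS hm hM hx hL hε hLε
    (ρ := √(125 * S.errBound M / S.sbar) + η / 8) (by positivity) ?_).trans ?_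
  · have h1 : 1000 * S.errBound M = 8 * S.sbar * √(125 * S.errBound M / S.sbar) ^ 2 := by
      rw [Real.sq_sqrt (by positivity)]
      field_simp
      ring
    rw [h1]
    gcongr
    linarith
  · rw [mul_add, mul_div_cancel₀ _ (by norm_num : (8 : ℝ) ≠ 0),
      ENNReal.ofReal_add (by positivity) hη'.le, ENNReal.ofReal_coe_nnreal]

end Reliable

/-! ### The bound in terms of the total number of observations -/

section Final

variable {E : Type v} [NormedAddCommGroup E] [InnerProductSpace ℝ E] [CompleteSpace E]
  [MeasurableSpace E] {S : Setting E} {M L : ℕ}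

/-- Here M is N/L with L ≤ a·l. The squares on the right anticipate the square root in the risk
bound and double the exponent, whence 2560 = 2·1280; 688128 is 21504·32. -/
lemma Setting.Standing.errBound_le (hS : S.Standing) (hm : 1 < S.m₀) {a l : ℝ} (ha : 0 < a)
    (hl : 0 < l) (hL : 0 < L) (hM : 0 < M) (hLl : (L : ℝ) ≤ a * l) (ha1 : 1 ≤ a) :
    S.errBound M ≤ 688128 * a *
      ((S.R * Real.exp (-(1 / (2560 * a) * (L * M : ℕ) * S.κ)
          / (S.Θ * S.ϰ * S.sbar * S.ν * l))) ^ 2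
        + (S.ς * S.sbar / S.κ * √(S.Θ * S.ϰ' * l / (L * M : ℕ))) ^ 2) := by
  have hs := hS.sbar_pos hm
  have hν := hS.ν_pos hm
  have hκ := hS.κ_pos
  have hϰ := hS.ϰ_pos
  have hϰ' := hS.ϰ'_pos
  have hΘ := hS.Θ_pos
  have hT := hS.stageCost_pos hm
  have hM0 : (0 : ℝ) < M := by exact_mod_cast hM
  have hL0 : (0 : ℝ) < L := by exact_mod_cast hL
  have e1 : Real.exp (-(M / (1280 * S.stageCost))) ≤ Real.exp (-(1 / (2560 * a) *
      (L * M : ℕ) * S.κ) / (S.Θ * S.ϰ * S.sbar * S.ν * l)) ^ 2 := by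
    rw [← Real.exp_nat_mul]
    refine Real.exp_le_exp.mpr ?_
    have e : ((2 : ℕ) : ℝ) * (-(1 / (2560 * a) * (L * M : ℕ) * S.κ)
        / (S.Θ * S.ϰ * S.sbar * S.ν * l)) = -(M / (1280 * S.stageCost) * (L / (a * l))) := by
      rw [Setting.stageCost]
      push_cast
      field_simp
      norm_num
    rw [e]
    exact neg_le_neg (mul_le_of_le_one_right (by positivity)
      ((div_le_one (by positivity)).mpr hLl))
  have e2 : S.noiseFloor * (S.stageCost / M) ≤
      32 * a * (S.ς * S.sbar / S.κ * √(S.Θ * S.ϰ' * l / (L * M : ℕ))) ^ 2 := by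
    rw [mul_pow, Real.sq_sqrt (by positivity)]
    have e : S.noiseFloor * (S.stageCost / M) =
        32 * ((S.ς * S.sbar / S.κ) ^ 2 * (S.Θ * S.ϰ' / M)) := by
      rw [Setting.noiseFloor, Setting.stageCost]
      field_simp
    rw [e, mul_assoc]
    have : S.Θ * S.ϰ' / M ≤ a * (S.Θ * S.ϰ' * l / (L * M : ℕ)) := by
      push_cast
      rw [mul_div_assoc', div_le_div_iff₀ hM0 (by positivity)]
      have := mul_le_mul_of_nonneg_left hLl (show 0 ≤ S.Θ * S.ϰ' * M by positivity)
      linarith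
    calc _ ≤ 32 * ((S.ς * S.sbar / S.κ) ^ 2 * (a * (S.Θ * S.ϰ' * l / (L * M : ℕ)))) := by
          gcongr
      _ = _ := by ring
  have e3 := mul_le_mul_of_nonneg_left e1 (sq_nonneg S.R)
  rw [← mul_pow] at e3
  have e4 := mul_le_mul_of_nonneg_right (show (1 : ℝ) ≤ 32 * a by linarith)
    (sq_nonneg (S.R * Real.exp (-(1 / (2560 * a) *
      (L * M : ℕ) * S.κ) / (S.Θ * S.ϰ * S.sbar * S.ν * l))))
  rw [Setting.errBound]
  linarith

end Final

end SMDSR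

end

theorem theorem2 (rule : SMDSR.Rule) (α : ℝ) (hα : rule.α₀ ≤ α) :
    ∃ c C : ℝ, 0 < c ∧ 0 < C ∧
      ∀ (E : Type*) [NormedAddCommGroup E] [InnerProductSpace ℝ E] [FiniteDimensional ℝ E]
        [CompleteSpace E] [MeasurableSpace E] [BorelSpace E]
        (S : SMDSR.Setting E), S.Standing → 1 < S.m₀ →
        ∀ (ε : ℝ), 0 < ε → ε ≤ 1 / 4 →
        ∀ (N L M : ℕ), L = ⌈α * Real.log (1 / ε)⌉₊ → N = L * M → L * S.m₀ ≤ N →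
        ∀ (xbar ybar : SMDSR.Estimator E L M),
          (∀ Q ∈ S.problems, ∀ w, rule.IsOutput (fun l => S.xhat Q (w l)) (xbar Q w)) →
          (∀ Q ∈ S.problems, ∀ w, ybar Q w = S.sparse (xbar Q w)) →
          SMDSR.epsRisk S.nrm ε S.problems ybar
              ≤ ENNReal.ofReal √(2 * S.s) * SMDSR.epsRisk norm ε S.problems ybar ∧
          ENNReal.ofReal √(2 * S.s) * SMDSR.epsRisk norm ε S.problems ybar
              ≤ ENNReal.ofReal (2 * √(2 * S.s)) * SMDSR.epsRisk norm ε S.problems xbar ∧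
          ENNReal.ofReal (2 * √(2 * S.s)) * SMDSR.epsRisk norm ε S.problems xbar
              ≤ ENNReal.ofReal (C *
                (S.R * Real.exp (-(c * N * S.κ) / (S.Θ * S.ϰ * S.sbar * S.ν * Real.log (1 / ε)))
                  + S.ς * S.sbar / S.κ * √(S.Θ * S.ϰ' * Real.log (1 / ε) / N))) := by
  have hα10 : 10 ≤ α := by
    refine le_trans ?_ hα
    cases rule <;> norm_num [SMDSR.Rule.α₀]
  -- The factor α + 1 bounds L/ln(1/ε), rounding included, because ln(1/ε) ≥ ln 4 > 1. The constant
  -- 300000 has a square above 64000·688128.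
  refine ⟨1 / (2560 * (α + 1)), 300000 * (α + 1), by positivity, by positivity, ?_⟩
  intro E _ _ _ _ _ _ S hS hm ε hε hε4 N L M hLdef hN hNm xbar ybar hx hy
  have hlog : 1.38 ≤ Real.log (1 / ε) := by
    have h1 : Real.log 4 ≤ Real.log (1 / ε) :=
      Real.log_le_log (by norm_num) (by rw [le_div_iff₀ hε]; linarith)
    have h2 : Real.log 4 = 2 * Real.log 2 := by
      rw [show (4 : ℝ) = 2 ^ 2 by norm_num, Real.log_pow]; norm_num
    linarith [Real.log_two_gt_d9]
  set l := Real.log (1 / ε) with hl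
  have hLge : α * l ≤ L := hLdef ▸ Nat.le_ceil _
  have hLle : (L : ℝ) ≤ (α + 1) * l := by
    have : (L : ℝ) < α * l + 1 := hLdef ▸ Nat.ceil_lt_add_one (by positivity)
    linarith
  -- From α ≥ 10 and ln(1/ε) ≥ 1.38.
  have hL12 : 12 ≤ L := by
    have : (12 : ℝ) ≤ L := by nlinarith
    exact_mod_cast this
  have hLε : l ≤ L := by nlinarith
  have hM : S.m₀ ≤ M := Nat.le_of_mul_le_mul_left (hN ▸ hNm) (by omega)
  have hxX : ∀ Q ∈ S.problems, ∀ w, xbar Q w ∈ S.X := fun Q hQ w =>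
    (hx Q hQ w).mem (by omega) hS.convex hS.closed fun l =>
      SMDSR.Setting.InClass.xhat_mem hS hQ hm hM (w l)
  refine ⟨?_, ?_, ?_⟩
  · refine SMDSR.epsRisk_le_ofReal_mul (Real.sqrt_nonneg _) fun Q hQ w => ?_
    rw [hy Q hQ w]
    exact hS.nrm_le _ (by linarith [hS.s_nonneg]) _
      (hS.sparse_sub _ _ (hS.sparse_sparse _ (hxX Q hQ w)) hQ.xstar_sparse)
  · have h : SMDSR.epsRisk norm ε S.problems ybar ≤
        ENNReal.ofReal 2 * SMDSR.epsRisk norm ε S.problems xbar :=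
      SMDSR.epsRisk_le_ofReal_mul zero_le_two fun Q hQ w => by
        rw [hy Q hQ w]
        have h1 := hS.sparse_min _ (hxX Q hQ w) _ hQ.xstar_mem hQ.xstar_sparse
        have h2 := norm_sub_le_norm_sub_add_norm_sub (S.sparse (xbar Q w)) (xbar Q w) Q.xstar
        rw [norm_sub_rev (S.sparse (xbar Q w)) (xbar Q w)] at h2
        linarith
    calc _ ≤ ENNReal.ofReal √(2 * S.s) *
          (ENNReal.ofReal 2 * SMDSR.epsRisk norm ε S.problems xbar) := by gcongr
      _ = _ := by rw [ENNReal.ofReal_mul zero_le_two]; ring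
  -- A member of the class is needed to know R ≥ 0; for the empty class the risk is zero.
  · rcases S.problems.eq_empty_or_nonempty with h𝒳 | ⟨Q₀, hQ₀⟩
    · have h0 : SMDSR.epsRisk norm ε S.problems xbar ≤ 0 :=
        SMDSR.epsRisk_le_of_forall fun Q hQ => absurd hQ (h𝒳 ▸ Set.notMem_empty Q)
      rw [nonpos_iff_eq_zero.mp h0, mul_zero]
      exact zero_le
    have hR : 0 ≤ S.R := SMDSR.Setting.InClass.R_nonneg hQ₀
    have hs := hS.sbar_pos hm
    have hκ := hS.κ_pos
    have hς := hS.ς_nonneg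
    have hM0 : 0 < M := (zero_lt_one.trans hm).trans_le hM
    have he : 0 ≤ S.errBound M := by
      have h1 := hS.noiseFloor_nonneg hm
      have h2 := hS.stageCost_pos hm
      rw [SMDSR.Setting.errBound]
      positivity
    have hb := hS.errBound_le (L := L) (M := M) (a := α + 1) (l := l) hm (by linarith)
      (by linarith) (by omega) hM0 hLle (by linarith)
    rw [← hN] at hb
    set a := S.R * Real.exp (-(1 / (2560 * (α + 1)) * N * S.κ) / (S.Θ * S.ϰ * S.sbar * S.ν * l))
    set b := S.ς * S.sbar / S.κ * √(S.Θ * S.ϰ' * l / N)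
    have ha0 : 0 ≤ a := by positivity
    have hb0 : 0 ≤ b := by positivity
    refine (mul_le_mul_right (SMDSR.epsRisk_aggregate_le_sqrt hS hm hM hx hL12 hε hLε he) _).trans ?_
    rw [← ENNReal.ofReal_mul (by positivity)]
    refine ENNReal.ofReal_le_ofReal (le_of_sq_le_sq ?_ (by positivity))
    calc (2 * √(2 * S.s) * (8 * √(125 * S.errBound M / S.sbar))) ^ 2
        = 256 * (2 * S.s) * (125 * S.errBound M / S.sbar) := by
          have h1 := Real.sq_sqrt (show 0 ≤ 2 * S.s by linarith [hS.s_nonneg])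
          have h2 := Real.sq_sqrt (show 0 ≤ 125 * S.errBound M / S.sbar by positivity)
          rw [mul_pow, mul_pow, mul_pow, h1, h2]
          ring
      _ ≤ 256 * (2 * S.sbar) * (125 * S.errBound M / S.sbar) := by
          gcongr
          exact hS.s_le
      _ = 64000 * S.errBound M := by field_simp; ring
      _ ≤ 64000 * (688128 * (α + 1) * (a ^ 2 + b ^ 2)) := by gcongr
      _ ≤ 90000000000 * (α + 1) * (a ^ 2 + b ^ 2) := by
          have : 0 ≤ (α + 1) * (a ^ 2 + b ^ 2) := by positivity
          linarith
      _ ≤ 90000000000 * (α + 1) ^ 2 * (a + b) ^ 2 := by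
          gcongr
          · nlinarith
          · nlinarith [mul_nonneg ha0 hb0]
      _ = (300000 * (α + 1) * (a + b)) ^ 2 := by ring
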